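/- Let $\ell,h>0$ and $0<V^-<V^+$, and put $V(x)=V^-$ for $x<0$, $V(x)=V^+$ for $x\ge 0$. Let $w:\mathbb R\to[0,\infty)$ vanish outside $[0,h]$, be Lipschitz and differentiable on $[0,h]$ (one-sidedly at the endpoints), with $\int_0^h w=1$, $w(h)=0$ and $w'<0$ on $[0,h]$. Let $\phi:[0,1]\to[0,1]$ be $C^2$ with $\phi(0)=1$, $\phi(1)=0$, $\phi'<0$ and $\phi''\le 0$ on $[0,1]$; put $f(\rho)=\rho\phi(\rho)$ and let $\hat\rho\in[0,1]$ be the unique point with $f'(\hat\rho)=0$. For $P:\mathbb R\to(0,1]$ let $L^P(x)=x+\ell/P(x)$; let $(L^P)^k$, $k\in\mathbb Z$, be its iterates (leaders for $k\ge0$, followers for $k<0$), let $P^\ell_{\{x\}}(y)=P((L^P)^k(x))$ for $y\in[(L^P)^k(x),(L^P)^{k+1}(x))$, and for a density $p$ let $$v^*(x;p)=\int_x^{x+h}V(y)\,\phi(p(y))\,w(y-x)\,dy .$$ Consider the problem of finding a $C^1$ function $P:\mathbb R\to(0,1]$ with $v^*(x;P^\ell_{\{x\}})>0$ and $$P'(x)=\frac{P(x)^2}{\ell\,v^*(x;P^\ell_{\{x\}})}\Big[v^*(x;P^\ell_{\{x\}})-v^*(L^P(x);P^\ell_{\{x\}})\Big]\quad(x\in\mathbb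 R),\qquad \lim_{x\to\pm\infty}P(x)=\rho^\pm. \tag{1}$$ Let $0<\rho^+<\rho^-\le\hat\rho$ and $V^-f(\rho^-)=V^+f(\rho^+)$. Then (1) has exactly one solution $P$. It satisfies $P(x)=\rho^+$ for all $x\ge0$ and is strictly decreasing on $x<0$. Moreover $P$ is a stationary wave profile of the follow-the-leaders system: for every sequence $(z_i^0)_{i\in\mathbb Z}$ with $z^0_{i+1}=L^P(z^0_i)$ there are functions $z_i:[0,\infty)\to\mathbb R$ with $z_i(0)=z_i^0$, $z_i(t)\le z_{i+1}(t)-\ell$, $$\dot z_i(t)=v^*(z_i(t);\rho^\ell(t,\cdot)),\qquad \rho^\ell(t,y)=\rho_i(t):=\frac{\ell}{z_{i+1}(t)-z_i(t)}\ \text{ for } y\in[z_i(t),z_{i+1}(t)),$$ such that $P(z_i(t))=\rho_i(t)$ for all $i\in\mathbb Z$ and $t\ge 0$. -/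

import Mathlib

open Set Filter Topology MeasureTheory

noncomputable section

/-- The weight function `w`, supported on `[0, h]`; derivatives at the endpoints are one-sided. -/
structure IsWeight (h : ℝ) (w : ℝ → ℝ) : Prop where
  support : ∀ x, x ∉ Icc 0 h → w x = 0
  nonneg : ∀ x, 0 ≤ w x
  lipschitz : ∃ K : NNReal, LipschitzOnWith K w (Icc 0 h)
  integral_eq_one : ∫ x in (0 : ℝ)..h, w x = 1
  right_end : w h = 0
  differentiable : DifferentiableOn ℝ w (Icc 0 h)
  deriv_neg : ∀ x ∈ Icc 0 h, derivWithin w (Icc 0 h) x < 0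

/-- The speed-density function `φ : [0, 1] → [0, 1]`; derivatives at the endpoints are
one-sided, and the values of `φ` outside `[0, 1]` play no role. -/
structure IsSpeedFunction (φ : ℝ → ℝ) : Prop where
  mapsTo : MapsTo φ (Icc 0 1) (Icc 0 1)
  contDiffOn : ContDiffOn ℝ 2 φ (Icc 0 1)
  at_one : φ 1 = 0
  at_zero : φ 0 = 1
  deriv_neg : ∀ ρ ∈ Icc (0 : ℝ) 1, derivWithin φ (Icc 0 1) ρ < 0
  deriv_two_nonpos : ∀ ρ ∈ Icc (0 : ℝ) 1, iteratedDerivWithin 2 φ (Icc 0 1) ρ ≤ 0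

/-- The speed limit: `Vm` on `x < 0`, `Vp` on `x ≥ 0`. -/
def speedLimit (Vm Vp : ℝ) (x : ℝ) : ℝ := if x < 0 then Vm else Vp

/-- `f(ρ) = ρ φ(ρ)`. -/
def fluxFn (φ : ℝ → ℝ) (ρ : ℝ) : ℝ := ρ * φ ρ

/-- The position `L^P(x) = x + ℓ / P(x)` of the leader of the car at `x`. -/
def leader (ℓ : ℝ) (P : ℝ → ℝ) (x : ℝ) : ℝ := x + ℓ / P x

/-- `(L^P)^k(x)` for `k ∈ ℤ`: iterated leaders for `k ≥ 0`, iterated followers for `k < 0`. -/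
def carPosition (ℓ : ℝ) (P : ℝ → ℝ) (x : ℝ) : ℤ → ℝ
  | Int.ofNat n => (leader ℓ P)^[n] x
  | Int.negSucc n => (Function.invFun (leader ℓ P))^[n + 1] x

open Classical in
/-- The piecewise constant function equal to `a k` on `[z k, z (k + 1))`, for all `k ∈ ℤ`
(and `0` at points that lie in none of these intervals). -/
def stepFunction (z a : ℤ → ℝ) (y : ℝ) : ℝ :=
  if hk : ∃ k : ℤ, y ∈ Ico (z k) (z (k + 1)) then a hk.choose else 0

/-- The piecewise constant density `P^ℓ_{x}` that the profile `P` and a car at `x` generate. -/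
def profileDensity (ℓ : ℝ) (P : ℝ → ℝ) (x : ℝ) : ℝ → ℝ :=
  stepFunction (carPosition ℓ P x) (fun k => P (carPosition ℓ P x k))

/-- The averaged speed `v^*(x; p) = ∫_x^{x+h} V(y) φ(p(y)) w(y - x) dy`. -/
def avgSpeed (h : ℝ) (V φ w p : ℝ → ℝ) (x : ℝ) : ℝ :=
  ∫ y in x..(x + h), V y * φ (p y) * w (y - x)

/-- `P` is a continuously differentiable solution, with values in `(0, 1]`, of the delay
integro-differential profile equation
`P'(x) = P(x)² / (ℓ v^*(x; P^ℓ_{x})) * (v^*(x; P^ℓ_{x}) - v^*(L^P(x); P^ℓ_{x}))`. -/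
structure SolvesProfileEq (ℓ h : ℝ) (V φ w P : ℝ → ℝ) : Prop where
  contDiff : ContDiff ℝ 1 P
  pos : ∀ x, 0 < P x
  le_one : ∀ x, P x ≤ 1
  speed_pos : ∀ x, 0 < avgSpeed h V φ w (profileDensity ℓ P x) x
  deriv_eq : ∀ x, deriv P x =
    P x ^ 2 / (ℓ * avgSpeed h V φ w (profileDensity ℓ P x) x) *
      (avgSpeed h V φ w (profileDensity ℓ P x) x -
        avgSpeed h V φ w (profileDensity ℓ P x) (leader ℓ P x))

/-- The asymptotic value problem: the profile equation together with the limits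
`ρm` at `-∞` and `ρp` at `+∞`. -/
structure SolvesAsymptoticValueProblem (ℓ h : ℝ) (V φ w : ℝ → ℝ) (ρm ρp : ℝ)
    (P : ℝ → ℝ) : Prop extends SolvesProfileEq ℓ h V φ w P where
  tendsto_atBot : Tendsto P atBot (𝓝 ρm)
  tendsto_atTop : Tendsto P atTop (𝓝 ρp)

/-- The discrete density `ρ_i = ℓ / (z_{i+1} - z_i)` of a car distribution. -/
def discreteDensity (ℓ : ℝ) (z : ℤ → ℝ) (i : ℤ) : ℝ := ℓ / (z (i + 1) - z i)

/-- `z i t` is the position of the `i`-th car at time `t ≥ 0`, and the cars solve the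
follow-the-leaders system. -/
structure IsFtLsSolution (ℓ h : ℝ) (V φ w : ℝ → ℝ) (z : ℤ → ℝ → ℝ) : Prop where
  ordered : ∀ t, 0 ≤ t → ∀ i, z i t ≤ z (i + 1) t - ℓ
  hasDeriv : ∀ t, 0 ≤ t → ∀ i, HasDerivWithinAt (z i)
    (avgSpeed h V φ w
      (stepFunction (fun j => z j t) (discreteDensity ℓ (fun j => z j t))) (z i t))
    (Ici 0) t

/-- `P` is a stationary wave profile of the follow-the-leaders system: from every car
distribution generated by `P` starts a solution along which `P(z_i(t)) = ρ_i(t)` for all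
`i` and `t ≥ 0`. -/
def IsStationaryWaveProfile (ℓ h : ℝ) (V φ w P : ℝ → ℝ) : Prop :=
  ∀ z₀ : ℤ → ℝ, (∀ i, z₀ (i + 1) = leader ℓ P (z₀ i)) →
    ∃ z : ℤ → ℝ → ℝ, IsFtLsSolution ℓ h V φ w z ∧ (∀ i, z i 0 = z₀ i) ∧
      ∀ i t, 0 ≤ t → P (z i t) = discreteDensity ℓ (fun j => z j t) i

end

/-!
The profile equation is solved along the trajectory of a car. In terms of the leader map `L` and the
averaged speed `A(x) = v^*(x; P^ℓ_{x})` it says `L'(x) = A(L x) / A(x)`, that is, the travel time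
`∫_x^{L x} dy / A(y)` from a car to its leader is a constant `τ`. Hence if `Z' = A(Z)`, every car
repeats the motion of its leader with delay `τ`: `L(Z t) = Z (t + τ)` and
`P(Z t) = ℓ / (Z (t + τ) - Z t)`, and `Z` solves an equation with advanced arguments,
`Z'(t) = G (Z t, Z (t + τ), Z (t + 2τ), …)`. Here `G` is `queueSpeed`, a finite sum that extends the
averaged speed to all sequences of positions, and is bounded and Lipschitz continuous.

Prescribing `Z(t) = c t` for `t ≥ 0`, with `c = Vp φ(ρp)` and `τ = ℓ / (ρp c)`, the equation has
exactly one solution, by a weighted contraction argument (`existsUnique_isAdvancedSolution`).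

For existence, it must be shown that the gap `D(t) = Z (t + τ) - Z t` is strictly increasing on
`t ≤ 0`, stays above `ℓ / ρm`, and tends to `ℓ / ρm` at `-∞`. The central point is a comparison
(`queueSpeed_succ_sub_ge`): when gaps do not decrease towards the front, a car is no faster than its
leader, because both the speed limit and the speeds allowed by the gaps are nondecreasing in space.
Together with `D(t) = τ Z'(ξ)` and `τ Vm φ(ρm) = ℓ / ρm`, which is the flux condition, this closes a
continuation argument backwards from time `0` (`lt_gapAlong_and_speedAlong_lt`). The limit of `D`
follows from the injectivity of the flux below the stagnation density.

For uniqueness, a solution `Q` has a travel time `τ` that is determined by the state at `+∞`, and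
the mean value form `τ A(ξ) Q(x) = ℓ` with some `ξ > x` forces `Q = ρp` on `x ≥ 0` (`eq_of_nonneg`).
Thus `Q` comes from a solution of the same equation with advanced arguments and the same data for
`t ≥ 0`, of which there is only one.
-/

noncomputable section

/-! ### The speed function and the flux -/

namespace IsSpeedFunction

variable {φ : ℝ → ℝ}

theorem continuousOn (hφ : IsSpeedFunction φ) : ContinuousOn φ (Icc 0 1) :=
  hφ.contDiffOn.continuousOn

theorem strictAntiOn (hφ : IsSpeedFunction φ) : StrictAntiOn φ (Icc 0 1) := by
  refine strictAntiOn_of_deriv_neg (convex_Icc 0 1) hφ.continuousOn fun x hx => ?_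
  rw [← derivWithin_of_mem_nhds (mem_interior_iff_mem_nhds.mp hx)]
  exact hφ.deriv_neg x (interior_subset hx)

theorem pos (hφ : IsSpeedFunction φ) {ρ : ℝ} (h0 : 0 ≤ ρ) (h1 : ρ < 1) : 0 < φ ρ := by
  have := hφ.strictAntiOn ⟨h0, h1.le⟩ (right_mem_Icc.mpr zero_le_one) h1
  rwa [hφ.at_one] at this

theorem exists_lipschitz (hφ : IsSpeedFunction φ) :
    ∃ K : ℝ, 0 ≤ K ∧ ∀ x ∈ Icc (0 : ℝ) 1, ∀ y ∈ Icc (0 : ℝ) 1, |φ x - φ y| ≤ K * |x - y| := by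
  obtain ⟨K, hK⟩ := hφ.contDiffOn.exists_lipschitzOnWith two_ne_zero (convex_Icc 0 1) isCompact_Icc
  exact ⟨K, K.2, fun x hx y hy => by simpa [Real.dist_eq] using hK.dist_le_mul x hx y hy⟩

theorem antitoneOn_derivWithin (hφ : IsSpeedFunction φ) :
    AntitoneOn (derivWithin φ (Icc 0 1)) (Icc 0 1) := by
  have hd : DifferentiableOn ℝ (derivWithin φ (Icc 0 1)) (Icc 0 1) :=
    (hφ.contDiffOn.derivWithin (m := 1) (uniqueDiffOn_Icc zero_lt_one)
      (by norm_num)).differentiableOn one_ne_zero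
  refine antitoneOn_of_deriv_nonpos (convex_Icc 0 1) hd.continuousOn
    (hd.mono interior_subset) fun x hx => ?_
  rw [← derivWithin_of_mem_nhds (mem_interior_iff_mem_nhds.mp hx)]
  have := hφ.deriv_two_nonpos x (interior_subset hx)
  rwa [iteratedDerivWithin_succ, iteratedDerivWithin_one] at this

theorem derivWithin_fluxFn (hφ : IsSpeedFunction φ) {x : ℝ} (hx : x ∈ Icc (0 : ℝ) 1) :
    derivWithin (fluxFn φ) (Icc 0 1) x = φ x + x * derivWithin φ (Icc 0 1) x := by
  have hd : HasDerivWithinAt φ (derivWithin φ (Icc 0 1) x) (Icc 0 1) x :=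
    (hφ.contDiffOn.differentiableOn two_ne_zero x hx).hasDerivWithinAt
  have := ((hasDerivWithinAt_id x (Icc (0 : ℝ) 1)).mul hd).derivWithin
    (uniqueDiffOn_Icc zero_lt_one x hx)
  rw [one_mul] at this
  exact this

theorem stagnation_lt_one (hφ : IsSpeedFunction φ) {ρhat : ℝ} (hρhat : ρhat ∈ Icc (0 : ℝ) 1)
    (hstag : derivWithin (fluxFn φ) (Icc 0 1) ρhat = 0) : ρhat < 1 := by
  refine lt_of_le_of_ne hρhat.2 fun h => ?_
  rw [hφ.derivWithin_fluxFn hρhat] at hstag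
  have := hφ.deriv_neg ρhat hρhat
  rw [h, hφ.at_one] at hstag
  rw [h] at this
  linarith

/-- The flux is strictly increasing up to the stagnation density. -/
theorem strictMonoOn_fluxFn (hφ : IsSpeedFunction φ) {ρhat : ℝ} (hρhat : ρhat ∈ Icc (0 : ℝ) 1)
    (hstag : derivWithin (fluxFn φ) (Icc 0 1) ρhat = 0) :
    StrictMonoOn (fluxFn φ) (Icc 0 ρhat) := by
  have hsub : Icc 0 ρhat ⊆ Icc (0 : ℝ) 1 := Icc_subset_Icc_right hρhat.2
  refine strictMonoOn_of_deriv_pos (convex_Icc 0 ρhat)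
    ((continuousOn_id.mul hφ.continuousOn).mono hsub) fun x hx => ?_
  rw [interior_Icc] at hx
  have hx1 : x ∈ Icc (0 : ℝ) 1 := hsub (Ioo_subset_Icc_self hx)
  rw [← derivWithin_of_mem_nhds (Icc_mem_nhds hx.1 (hx.2.trans_le hρhat.2)),
    hφ.derivWithin_fluxFn hx1]
  rw [hφ.derivWithin_fluxFn hρhat] at hstag
  have h1 := hφ.strictAntiOn hx1 hρhat hx.2
  have h2 := hφ.antitoneOn_derivWithin hx1 hρhat hx.2.le
  have h3 := hφ.deriv_neg ρhat hρhat
  have h4 := mul_le_mul_of_nonneg_left h2 hx.1.le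
  have h5 := mul_le_mul_of_nonpos_right hx.2.le h3.le
  linarith

end IsSpeedFunction

/-- The speed (on a road with speed limit `1`) of a car whose leader is at distance `d`. Distances
below the car length `ℓ` are treated as `ℓ`, so that the function is defined on all of `ℝ`. -/
def gapSpeed (ℓ : ℝ) (φ : ℝ → ℝ) (d : ℝ) : ℝ := φ (ℓ / max ℓ d)

section gapSpeed

variable {ℓ : ℝ} {φ : ℝ → ℝ}

theorem div_max_mem_Icc (hℓ : 0 < ℓ) (d : ℝ) : ℓ / max ℓ d ∈ Icc (0 : ℝ) 1 :=
  ⟨by positivity, div_le_one_of_le₀ (le_max_left _ _) (by positivity)⟩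

theorem gapSpeed_mem_Icc (hφ : IsSpeedFunction φ) (hℓ : 0 < ℓ) (d : ℝ) :
    gapSpeed ℓ φ d ∈ Icc (0 : ℝ) 1 :=
  hφ.mapsTo (div_max_mem_Icc hℓ d)

theorem gapSpeed_nonneg (hφ : IsSpeedFunction φ) (hℓ : 0 < ℓ) (d : ℝ) : 0 ≤ gapSpeed ℓ φ d :=
  (gapSpeed_mem_Icc hφ hℓ d).1

theorem gapSpeed_div (hℓ : 0 < ℓ) {ρ : ℝ} (h0 : 0 < ρ) (h1 : ρ ≤ 1) :
    gapSpeed ℓ φ (ℓ / ρ) = φ ρ := by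
  rw [gapSpeed, max_eq_right, div_div_cancel₀ hℓ.ne']
  exact (le_div_iff₀ h0).mpr (mul_le_of_le_one_right hℓ.le h1)

theorem gapSpeed_of_le {d : ℝ} (hd : ℓ ≤ d) : gapSpeed ℓ φ d = φ (ℓ / d) := by
  rw [gapSpeed, max_eq_right hd]

theorem gapSpeed_monotone (hφ : IsSpeedFunction φ) (hℓ : 0 < ℓ) : Monotone (gapSpeed ℓ φ) :=
  fun a b hab => hφ.strictAntiOn.antitoneOn (div_max_mem_Icc hℓ b) (div_max_mem_Icc hℓ a)
    (div_le_div_of_nonneg_left hℓ.le (by positivity) (max_le_max_left _ hab))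

theorem gapSpeed_strictMonoOn (hφ : IsSpeedFunction φ) (hℓ : 0 < ℓ) :
    StrictMonoOn (gapSpeed ℓ φ) (Ici ℓ) := by
  intro a ha b hb hab
  refine hφ.strictAntiOn (div_max_mem_Icc hℓ b) (div_max_mem_Icc hℓ a) ?_
  rw [max_eq_right (mem_Ici.mp ha), max_eq_right (mem_Ici.mp hb)]
  exact div_lt_div_of_pos_left hℓ (hℓ.trans_le ha) hab

theorem gapSpeed_exists_lipschitz (hφ : IsSpeedFunction φ) (hℓ : 0 < ℓ) :
    ∃ K : ℝ, 0 ≤ K ∧ ∀ a b, |gapSpeed ℓ φ a - gapSpeed ℓ φ b| ≤ K * |a - b| := by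
  obtain ⟨K, hK, h⟩ := hφ.exists_lipschitz
  refine ⟨K / ℓ, by positivity, fun a b => ?_⟩
  refine (h _ (div_max_mem_Icc hℓ a) _ (div_max_mem_Icc hℓ b)).trans ?_
  rw [div_mul_eq_mul_div, mul_div_assoc]
  refine mul_le_mul_of_nonneg_left ?_ hK
  have ha : 0 < max ℓ a := by positivity
  have hb : 0 < max ℓ b := by positivity
  have hab : |max ℓ b - max ℓ a| ≤ |a - b| := by
    rw [abs_sub_comm a b, max_comm ℓ b, max_comm ℓ a]
    exact abs_max_sub_max_le_abs _ _ _
  have he : ℓ / max ℓ a - ℓ / max ℓ b = ℓ / max ℓ a * ((max ℓ b - max ℓ a) / max ℓ b) := by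
    field_simp
  rw [he, abs_mul, abs_of_nonneg (div_max_mem_Icc hℓ a).1, abs_div, abs_of_pos hb]
  calc ℓ / max ℓ a * (|max ℓ b - max ℓ a| / max ℓ b) ≤ 1 * (|a - b| / ℓ) := by
        gcongr
        · exact (div_max_mem_Icc hℓ a).2
        · exact le_max_left _ _
    _ = |a - b| / ℓ := one_mul _

theorem gapSpeed_continuous (hφ : IsSpeedFunction φ) (hℓ : 0 < ℓ) :
    Continuous (gapSpeed ℓ φ) :=
  hφ.continuousOn.comp_continuous
    (continuous_const.div (continuous_const.max continuous_id)
      fun d => (hℓ.trans_le (le_max_left ℓ d)).ne')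
    (div_max_mem_Icc hℓ)

end gapSpeed

/-! ### The distribution function of the weight -/

/-- The distribution function `s ↦ ∫_0^s w` of the weight. -/
def weightCDF (w : ℝ → ℝ) (s : ℝ) : ℝ := ∫ u in (0 : ℝ)..s, w u

namespace IsWeight

variable {h : ℝ} {w : ℝ → ℝ}

theorem continuousOn (hw : IsWeight h w) : ContinuousOn w (Icc 0 h) :=
  hw.differentiable.continuousOn

theorem pos (hw : IsWeight h w) {x : ℝ} (h0 : 0 ≤ x) (hx : x < h) : 0 < w x := by
  have hs : StrictAntiOn w (Icc 0 h) := by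
    refine strictAntiOn_of_deriv_neg (convex_Icc 0 h) hw.continuousOn fun x hx => ?_
    rw [← derivWithin_of_mem_nhds (mem_interior_iff_mem_nhds.mp hx)]
    exact hw.deriv_neg x (interior_subset hx)
  have := hs ⟨h0, hx.le⟩ (right_mem_Icc.mpr (h0.trans hx.le)) hx
  rwa [hw.right_end] at this

theorem integrable (hw : IsWeight h w) : Integrable w :=
  (integrableOn_iff_integrable_of_support_subset
    (fun x hx => by_contra fun h' => hx (hw.support x h'))).mp
    (hw.continuousOn.integrableOn_compact isCompact_Icc)

theorem intervalIntegrable (hw : IsWeight h w) (a b : ℝ) : IntervalIntegrable w volume a b :=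
  hw.integrable.intervalIntegrable

theorem exists_bound (hw : IsWeight h w) : ∃ B : ℝ, 0 ≤ B ∧ ∀ x, w x ≤ B := by
  obtain ⟨B, hB⟩ := isCompact_Icc.exists_bound_of_continuousOn hw.continuousOn
  refine ⟨|B|, abs_nonneg B, fun x => ?_⟩
  by_cases hx : x ∈ Icc 0 h
  · exact ((Real.norm_eq_abs _).symm ▸ le_abs_self _).trans ((hB x hx).trans (le_abs_self B))
  · rw [hw.support x hx]
    exact abs_nonneg B

theorem cdf_sub (hw : IsWeight h w) (a b : ℝ) :
    weightCDF w b - weightCDF w a = ∫ u in a..b, w u :=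
  intervalIntegral.integral_interval_sub_left (hw.intervalIntegrable _ _)
    (hw.intervalIntegrable _ _)

theorem cdf_monotone (hw : IsWeight h w) : Monotone (weightCDF w) := fun a b hab => by
  rw [← sub_nonneg, hw.cdf_sub]
  exact intervalIntegral.integral_nonneg hab fun u _ => hw.nonneg u

theorem cdf_of_nonpos (hw : IsWeight h w) {s : ℝ} (hs : s ≤ 0) : weightCDF w s = 0 := by
  rw [weightCDF, intervalIntegral.integral_symm, intervalIntegral.integral_congr_Ioo_of_le
    (g := fun _ => 0) hs fun x hx => hw.support x fun hx' => not_lt.mpr hx'.1 hx.2]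
  simp

theorem cdf_of_ge (hw : IsWeight h w) {s : ℝ} (hs : h ≤ s) : weightCDF w s = 1 := by
  have h1 : weightCDF w h = 1 := hw.integral_eq_one
  have h2 := hw.cdf_sub h s
  rw [intervalIntegral.integral_congr_Ioo_of_le (g := fun _ => 0) hs
    fun x hx => hw.support x fun hx' => not_lt.mpr hx'.2 hx.1] at h2
  simp only [intervalIntegral.integral_const, smul_zero] at h2
  linarith

theorem cdf_nonneg (hw : IsWeight h w) (s : ℝ) : 0 ≤ weightCDF w s := by
  rcases le_total s 0 with hs | hs
  · exact (hw.cdf_of_nonpos hs).ge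
  · rw [← hw.cdf_of_nonpos le_rfl]
    exact hw.cdf_monotone hs

theorem cdf_le_one (hw : IsWeight h w) (s : ℝ) : weightCDF w s ≤ 1 := by
  rcases le_total h s with hs | hs
  · exact (hw.cdf_of_ge hs).le
  · rw [← hw.cdf_of_ge le_rfl]
    exact hw.cdf_monotone hs

theorem cdf_pos (hw : IsWeight h w) (hh : 0 < h) {s : ℝ} (hs : 0 < s) : 0 < weightCDF w s := by
  have hm : 0 < min s h := lt_min hs hh
  refine lt_of_lt_of_le ?_ (hw.cdf_monotone (min_le_left s h))
  exact intervalIntegral.intervalIntegral_pos_of_pos_on (hw.intervalIntegrable _ _)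
    (fun x hx => hw.pos hx.1.le (hx.2.trans_le (min_le_right s h))) hm

theorem cdf_exists_lipschitz (hw : IsWeight h w) :
    ∃ B : ℝ, 0 ≤ B ∧ ∀ a b, |weightCDF w a - weightCDF w b| ≤ B * |a - b| := by
  obtain ⟨B, hB, hb⟩ := hw.exists_bound
  refine ⟨B, hB, fun a b => ?_⟩
  rw [hw.cdf_sub, ← Real.norm_eq_abs]
  refine intervalIntegral.norm_integral_le_of_norm_le_const fun x _ => ?_
  rw [Real.norm_eq_abs, abs_of_nonneg (hw.nonneg x)]
  exact hb x

theorem cdf_continuous (hw : IsWeight h w) : Continuous (weightCDF w) := by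
  obtain ⟨B, hB, hb⟩ := hw.cdf_exists_lipschitz
  exact (LipschitzWith.of_dist_le_mul (K := ⟨B, hB⟩) fun a b => by
    rw [Real.dist_eq, Real.dist_eq]
    exact hb a b).continuous

end IsWeight

/-! ### The speed of a car as a function of the positions of its leaders -/

/-- Up to a constant depending on `x`, the primitive at `b` of `y ↦ V(y) w(y - x)`, where `V` is the
speed limit. -/
def lookAhead (Vm Vp : ℝ) (w : ℝ → ℝ) (x b : ℝ) : ℝ :=
  Vm * weightCDF w (b - x) + (Vp - Vm) * weightCDF w (max b 0 - x)

/-- The averaged speed of a car at `z 0` whose leaders are at `z 1, z 2, …`, of which the first `N`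
are taken into account. This is a finite sum that is defined, bounded and Lipschitz continuous for
all sequences `z`, and is the averaged speed of the model when consecutive cars are at least `ℓ`
apart and `h ≤ N * ℓ`. -/
def queueSpeed (ℓ Vm Vp : ℝ) (φ w : ℝ → ℝ) (N : ℕ) (z : ℕ → ℝ) : ℝ :=
  ∑ k ∈ Finset.range N, gapSpeed ℓ φ (z (k + 1) - z k) *
    (lookAhead Vm Vp w (z 0) (z (k + 1)) - lookAhead Vm Vp w (z 0) (z k))

section lookAhead

variable {h Vm Vp : ℝ} {w : ℝ → ℝ}

theorem lookAhead_mono (hw : IsWeight h w) (hVm : 0 < Vm) (hV : Vm < Vp) {x x' b b' : ℝ}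
    (hx : x' ≤ x) (hb : b ≤ b') : lookAhead Vm Vp w x b ≤ lookAhead Vm Vp w x' b' := by
  have hm : max b 0 ≤ max b' 0 := max_le_max_right 0 hb
  have h1 := hw.cdf_monotone (show b - x ≤ b' - x' by linarith)
  have h2 := hw.cdf_monotone (show max b 0 - x ≤ max b' 0 - x' by linarith)
  have hV' : 0 ≤ Vp - Vm := by linarith
  unfold lookAhead
  gcongr

theorem lookAhead_nonneg (hw : IsWeight h w) (hVm : 0 < Vm) (hV : Vm < Vp) (x b : ℝ) :
    0 ≤ lookAhead Vm Vp w x b :=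
  add_nonneg (mul_nonneg hVm.le (hw.cdf_nonneg _))
    (mul_nonneg (sub_nonneg.mpr hV.le) (hw.cdf_nonneg _))

theorem lookAhead_le (hw : IsWeight h w) (hVm : 0 < Vm) (hV : Vm < Vp) (x b : ℝ) :
    lookAhead Vm Vp w x b ≤ Vp := by
  have h1 := mul_le_mul_of_nonneg_left (hw.cdf_le_one (b - x)) hVm.le
  have h2 := mul_le_mul_of_nonneg_left (hw.cdf_le_one (max b 0 - x)) (sub_nonneg.mpr hV.le)
  unfold lookAhead
  linarith

theorem lookAhead_of_ge (hw : IsWeight h w) {x b : ℝ} (hb : x + h ≤ b) :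
    lookAhead Vm Vp w x b = Vp := by
  have hm : b ≤ max b 0 := le_max_left _ _
  rw [lookAhead, hw.cdf_of_ge (by linarith), hw.cdf_of_ge (by linarith)]
  ring

theorem lookAhead_self (hw : IsWeight h w) (x : ℝ) :
    lookAhead Vm Vp w x x = (Vp - Vm) * weightCDF w (-x) := by
  rw [lookAhead, sub_self, hw.cdf_of_nonpos le_rfl]
  rcases le_total x 0 with hx | hx
  · rw [max_eq_right hx]; simp
  · rw [max_eq_left hx, hw.cdf_of_nonpos (s := -x) (by linarith), sub_self,
      hw.cdf_of_nonpos le_rfl]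
    simp

theorem lookAhead_exists_lipschitz (hw : IsWeight h w) (hVm : 0 < Vm) (hV : Vm < Vp) :
    ∃ K : ℝ, 0 ≤ K ∧ ∀ x x' b b' ε : ℝ, |x - x'| ≤ ε → |b - b'| ≤ ε →
      |lookAhead Vm Vp w x b - lookAhead Vm Vp w x' b'| ≤ K * ε := by
  obtain ⟨B, hB, hb⟩ := hw.cdf_exists_lipschitz
  refine ⟨Vp * (B * 2), by have := hVm.trans hV; positivity, fun x x' b b' ε hx hbb => ?_⟩
  have hm : |max b 0 - max b' 0| ≤ ε := (abs_max_sub_max_le_abs b b' 0).trans hbb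
  have key : ∀ c c' : ℝ, |c - c'| ≤ ε →
      |weightCDF w (c - x) - weightCDF w (c' - x')| ≤ B * 2 * ε := fun c c' hc => by
    refine (hb _ _).trans ?_
    rw [mul_assoc]
    refine mul_le_mul_of_nonneg_left ?_ hB
    rw [abs_le] at *
    constructor <;> linarith
  have h1 := mul_le_mul_of_nonneg_left (key b b' hbb) hVm.le
  have h2 := mul_le_mul_of_nonneg_left (key _ _ hm) (sub_nonneg.mpr hV.le)
  calc _ = |Vm * (weightCDF w (b - x) - weightCDF w (b' - x')) + (Vp - Vm) *
        (weightCDF w (max b 0 - x) - weightCDF w (max b' 0 - x'))| := by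
        unfold lookAhead; congr 1; ring
    _ ≤ _ := abs_add_le _ _
    _ = Vm * |weightCDF w (b - x) - weightCDF w (b' - x')| + (Vp - Vm) *
        |weightCDF w (max b 0 - x) - weightCDF w (max b' 0 - x')| := by
        rw [abs_mul, abs_mul, abs_of_pos hVm, abs_of_pos (sub_pos.mpr hV)]
    _ ≤ Vp * (B * 2) * ε := by linarith

theorem integral_speedLimit_mul_weight (hw : IsWeight h w) (x : ℝ) {a b : ℝ} (hab : a ≤ b) :
    IntervalIntegrable (fun y => speedLimit Vm Vp y * w (y - x)) volume a b ∧
      ∫ y in a..b, speedLimit Vm Vp y * w (y - x) =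
        lookAhead Vm Vp w x b - lookAhead Vm Vp w x a := by
  set f : ℝ → ℝ := fun y => speedLimit Vm Vp y * w (y - x) with hf
  have hint : ∀ (c a b : ℝ), IntervalIntegrable (fun y => c * w (y - x)) volume a b :=
    fun c a b => (hw.integrable.comp_sub_right x).intervalIntegrable.const_mul c
  have hval : ∀ c a b : ℝ, ∫ y in a..b, c * w (y - x) =
      c * (weightCDF w (b - x) - weightCDF w (a - x)) := fun c a b => by
    rw [intervalIntegral.integral_const_mul, intervalIntegral.integral_comp_sub_right, hw.cdf_sub]
  have hneg : ∀ a b : ℝ, a ≤ b → b ≤ 0 → IntervalIntegrable f volume a b ∧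
      ∫ y in a..b, f y = lookAhead Vm Vp w x b - lookAhead Vm Vp w x a := by
    intro a b hab hb
    have he : EqOn (fun y => Vm * w (y - x)) f (Ioo a b) := fun y hy => by
      simp [hf, speedLimit, hy.2.trans_le hb]
    refine ⟨(hint Vm a b).congr_uIoo (by rwa [uIoo_of_le hab]), ?_⟩
    rw [← intervalIntegral.integral_congr_Ioo_of_le hab he, hval, lookAhead, lookAhead,
      max_eq_right hb, max_eq_right (hab.trans hb)]
    ring
  have hpos : ∀ a b : ℝ, a ≤ b → 0 ≤ a → IntervalIntegrable f volume a b ∧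
      ∫ y in a..b, f y = lookAhead Vm Vp w x b - lookAhead Vm Vp w x a := by
    intro a b hab ha
    have he : EqOn (fun y => Vp * w (y - x)) f (Ioo a b) := fun y hy => by
      simp [hf, speedLimit, not_lt.mpr (ha.trans hy.1.le)]
    refine ⟨(hint Vp a b).congr_uIoo (by rwa [uIoo_of_le hab]), ?_⟩
    rw [← intervalIntegral.integral_congr_Ioo_of_le hab he, hval, lookAhead, lookAhead,
      max_eq_left ha, max_eq_left (ha.trans hab)]
    ring
  rcases le_total b 0 with hb | hb
  · exact hneg a b hab hb
  rcases le_total 0 a with ha | ha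
  · exact hpos a b hab ha
  obtain ⟨i1, e1⟩ := hneg a 0 ha le_rfl
  obtain ⟨i2, e2⟩ := hpos 0 b hb le_rfl
  refine ⟨i1.trans i2, ?_⟩
  rw [← intervalIntegral.integral_add_adjacent_intervals i1 i2, e1, e2]
  ring

end lookAhead

/-! ### Averaged speeds of step functions -/

theorem add_nat_mul_le {ℓ : ℝ} {z : ℕ → ℝ} (hz : ∀ k, ℓ ≤ z (k + 1) - z k) (n : ℕ) :
    z 0 + n * ℓ ≤ z n := by
  induction n with
  | zero => simp
  | succ n ih => have := hz n; push_cast; linarith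

theorem stepFunction_apply {z : ℤ → ℝ} (hz : StrictMono z) (a : ℤ → ℝ) {k : ℤ} {y : ℝ}
    (hy : y ∈ Ico (z k) (z (k + 1))) : stepFunction z a y = a k := by
  have hk : ∃ k : ℤ, y ∈ Ico (z k) (z (k + 1)) := ⟨k, hy⟩
  have h1 := hk.choose_spec
  rw [stepFunction, dif_pos hk]
  congr 1
  have h2 := hz.lt_iff_lt.mp (h1.1.trans_lt hy.2)
  have h3 := hz.lt_iff_lt.mp (hy.1.trans_lt h1.2)
  omega

theorem avgSpeed_stepFunction {ℓ h Vm Vp : ℝ} {φ w : ℝ → ℝ} {N : ℕ} (hℓ : 0 < ℓ) (hh : 0 < h)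
    (hw : IsWeight h w) (hN : h ≤ N * ℓ) {z a : ℤ → ℝ} (hz : ∀ k, ℓ ≤ z (k + 1) - z k)
    (ha : ∀ k, a k = ℓ / (z (k + 1) - z k)) (i : ℤ) :
    avgSpeed h (speedLimit Vm Vp) φ w (stepFunction z a) (z i) =
      queueSpeed ℓ Vm Vp φ w N (fun k => z (i + k)) := by
  have hmono : StrictMono z := strictMono_int_of_lt_succ fun k => by linarith [hz k]
  set f : ℝ → ℝ := fun y => speedLimit Vm Vp y * φ (stepFunction z a y) * w (y - z i) with hf
  set u : ℕ → ℝ := fun k => z (i + k) with hu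
  have hstep : ∀ k, u (k + 1) = z (i + k + 1) := fun k => by simp [hu, add_assoc]
  have hug : ∀ k, ℓ ≤ u (k + 1) - u k := fun k => by rw [hstep]; exact hz _
  have hpiece : ∀ k, IntervalIntegrable f volume (u k) (u (k + 1)) ∧
      ∫ y in u k..u (k + 1), f y = gapSpeed ℓ φ (u (k + 1) - u k) *
        (lookAhead Vm Vp w (u 0) (u (k + 1)) - lookAhead Vm Vp w (u 0) (u k)) := by
    intro k
    have hle : u k ≤ u (k + 1) := by linarith [hug k]
    have hx : z i = u 0 := by simp [hu]
    obtain ⟨i1, e1⟩ := integral_speedLimit_mul_weight (Vm := Vm) (Vp := Vp) hw (u 0) hle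
    have he : EqOn (fun y => gapSpeed ℓ φ (u (k + 1) - u k) *
        (speedLimit Vm Vp y * w (y - u 0))) f (Ioo (u k) (u (k + 1))) := fun y hy => by
      have hs : stepFunction z a y = a (i + k) :=
        stepFunction_apply hmono a ⟨hy.1.le, by rw [← hstep]; exact hy.2⟩
      simp only [hf]
      rw [hs, ha, gapSpeed_of_le (hug k), hstep, ← hx]
      ring
    refine ⟨(i1.const_mul _).congr_uIoo (by rwa [uIoo_of_le hle]), ?_⟩
    rw [← intervalIntegral.integral_congr_Ioo_of_le hle he, intervalIntegral.integral_const_mul, e1]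
  have hx : z i = u 0 := by simp [hu]
  have hfar : u 0 + h ≤ u N := by linarith [add_nat_mul_le hug N]
  have hI : IntervalIntegrable f volume (u 0) (u N) :=
    IntervalIntegrable.trans_iterate fun k _ => (hpiece k).1
  have hsub1 : uIcc (u 0) (u 0 + h) ⊆ uIcc (u 0) (u N) := by
    rw [uIcc_of_le (by linarith), uIcc_of_le (by linarith)]
    exact Icc_subset_Icc_right hfar
  have hsub2 : uIcc (u 0 + h) (u N) ⊆ uIcc (u 0) (u N) := by
    rw [uIcc_of_le (by linarith), uIcc_of_le (by linarith)]
    exact Icc_subset_Icc_left (by linarith)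
  have hzero : ∫ y in (u 0 + h)..(u N), f y = 0 := by
    rw [intervalIntegral.integral_congr_Ioo_of_le (g := fun _ => 0) hfar fun y hy => ?_]
    · simp
    · simp only [hf]
      rw [hw.support (y - z i) fun hy' => ?_, mul_zero]
      linarith [hy.1, hy'.2]
  rw [avgSpeed, hx]
  calc ∫ y in (u 0)..(u 0 + h), speedLimit Vm Vp y * φ (stepFunction z a y) * w (y - u 0)
      = ∫ y in (u 0)..(u 0 + h), f y := by rw [← hx]
    _ = ∫ y in (u 0)..(u N), f y := by
        rw [← intervalIntegral.integral_add_adjacent_intervals (hI.mono_set hsub1)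
          (hI.mono_set hsub2), hzero, add_zero]
    _ = _ := by
        rw [← intervalIntegral.sum_integral_adjacent_intervals fun k _ => (hpiece k).1]
        exact Finset.sum_congr rfl fun k _ => (hpiece k).2

/-! ### Bounds and comparison for the speed -/

section queueSpeed

variable {ℓ h Vm Vp : ℝ} {φ w : ℝ → ℝ} {N : ℕ}

theorem queueSpeed_continuous (hφ : IsSpeedFunction φ) (hw : IsWeight h w) (hℓ : 0 < ℓ)
    {X : Type*} [TopologicalSpace X] {z : X → ℕ → ℝ} (hz : ∀ k, Continuous fun t => z t k) :
    Continuous fun t => queueSpeed ℓ Vm Vp φ w N (z t) := by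
  have hg := gapSpeed_continuous hφ hℓ
  have hΩ := hw.cdf_continuous
  unfold queueSpeed lookAhead
  fun_prop

theorem abs_lookAhead_sub_le (hw : IsWeight h w) (hVm : 0 < Vm) (hV : Vm < Vp) (x b b' : ℝ) :
    |lookAhead Vm Vp w x b - lookAhead Vm Vp w x b'| ≤ Vp := by
  rw [abs_le]
  have h1 := lookAhead_nonneg hw hVm hV x b
  have h2 := lookAhead_nonneg hw hVm hV x b'
  have h3 := lookAhead_le hw hVm hV x b
  have h4 := lookAhead_le hw hVm hV x b'
  constructor <;> linarith

theorem abs_queueSpeed_le (hφ : IsSpeedFunction φ) (hw : IsWeight h w) (hℓ : 0 < ℓ)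
    (hVm : 0 < Vm) (hV : Vm < Vp) (z : ℕ → ℝ) : |queueSpeed ℓ Vm Vp φ w N z| ≤ N * Vp := by
  refine (Finset.abs_sum_le_sum_abs _ _).trans ?_
  refine (Finset.sum_le_card_nsmul _ _ Vp fun k _ => ?_).trans_eq (by simp)
  rw [abs_mul, abs_of_nonneg (gapSpeed_nonneg hφ hℓ _)]
  exact (mul_le_of_le_one_left (abs_nonneg _) (gapSpeed_mem_Icc hφ hℓ _).2).trans
    (abs_lookAhead_sub_le hw hVm hV _ _ _)

theorem queueSpeed_exists_lipschitz (hφ : IsSpeedFunction φ) (hw : IsWeight h w) (hℓ : 0 < ℓ)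
    (hVm : 0 < Vm) (hV : Vm < Vp) :
    ∃ K : ℝ, 0 ≤ K ∧ ∀ (z z' : ℕ → ℝ) (ε : ℝ), (∀ k, |z k - z' k| ≤ ε) →
      |queueSpeed ℓ Vm Vp φ w N z - queueSpeed ℓ Vm Vp φ w N z'| ≤ K * ε := by
  obtain ⟨Kg, hKg, hg⟩ := gapSpeed_exists_lipschitz hφ hℓ
  obtain ⟨KH, hKH, hH⟩ := lookAhead_exists_lipschitz hw hVm hV
  have hVp : 0 < Vp := hVm.trans hV
  refine ⟨N * (Kg * 2 * Vp + 2 * KH), by positivity, fun z z' ε hε => ?_⟩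
  have hε0 : 0 ≤ ε := (abs_nonneg _).trans (hε 0)
  unfold queueSpeed
  rw [← Finset.sum_sub_distrib]
  refine (Finset.abs_sum_le_sum_abs _ _).trans ?_
  refine (Finset.sum_le_card_nsmul _ _ ((Kg * 2 * Vp + 2 * KH) * ε) fun k _ => ?_).trans_eq
    (by simp [mul_assoc])
  set g := gapSpeed ℓ φ (z (k + 1) - z k)
  set g' := gapSpeed ℓ φ (z' (k + 1) - z' k)
  set a := lookAhead Vm Vp w (z 0) (z (k + 1)) - lookAhead Vm Vp w (z 0) (z k)
  set a' := lookAhead Vm Vp w (z' 0) (z' (k + 1)) - lookAhead Vm Vp w (z' 0) (z' k)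
  have h1 : |g - g'| ≤ Kg * (2 * ε) := by
    refine (hg _ _).trans (mul_le_mul_of_nonneg_left ?_ hKg)
    have h1 := hε k
    have h2 := hε (k + 1)
    rw [abs_le] at *
    constructor <;> linarith
  have h2 : |a - a'| ≤ 2 * KH * ε := by
    have h1 := hH _ _ _ _ ε (hε 0) (hε k)
    have h2 := hH _ _ _ _ ε (hε 0) (hε (k + 1))
    simp only [a, a']
    rw [abs_le] at *
    constructor <;> linarith
  have h3 : |a| ≤ Vp := abs_lookAhead_sub_le hw hVm hV _ _ _
  have h4 : |g'| ≤ 1 := by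
    rw [abs_of_nonneg (gapSpeed_nonneg hφ hℓ _)]
    exact (gapSpeed_mem_Icc hφ hℓ _).2
  calc |g * a - g' * a'| = |(g - g') * a + g' * (a - a')| := by congr 1; ring
    _ ≤ |g - g'| * |a| + |g'| * |a - a'| := by
        rw [← abs_mul, ← abs_mul]; exact abs_add_le _ _
    _ ≤ Kg * (2 * ε) * Vp + 1 * (2 * KH * ε) := by gcongr
    _ = (Kg * 2 * Vp + 2 * KH) * ε := by ring

theorem sum_lookAhead_sub (hw : IsWeight h w) (hN : h ≤ N * ℓ) {z : ℕ → ℝ}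
    (hz : ∀ k, ℓ ≤ z (k + 1) - z k) :
    ∑ k ∈ Finset.range N,
      (lookAhead Vm Vp w (z 0) (z (k + 1)) - lookAhead Vm Vp w (z 0) (z k)) =
      Vp - (Vp - Vm) * weightCDF w (-z 0) := by
  rw [Finset.sum_range_sub (fun k => lookAhead Vm Vp w (z 0) (z k)), lookAhead_self hw,
    lookAhead_of_ge hw (by linarith [add_nat_mul_le hz N])]

theorem lookAhead_succ_nonneg (hw : IsWeight h w) (hℓ : 0 < ℓ) (hVm : 0 < Vm) (hV : Vm < Vp)
    {z : ℕ → ℝ} (hz : ∀ k, ℓ ≤ z (k + 1) - z k) (k : ℕ) :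
    0 ≤ lookAhead Vm Vp w (z 0) (z (k + 1)) - lookAhead Vm Vp w (z 0) (z k) :=
  sub_nonneg.mpr (lookAhead_mono hw hVm hV le_rfl (by linarith [hz k]))

theorem queueSpeed_le (hw : IsWeight h w) (hℓ : 0 < ℓ) (hVm : 0 < Vm) (hV : Vm < Vp)
    (hN : h ≤ N * ℓ) {z : ℕ → ℝ} (hz : ∀ k, ℓ ≤ z (k + 1) - z k) {M : ℝ}
    (hM : ∀ k < N, gapSpeed ℓ φ (z (k + 1) - z k) ≤ M) :
    queueSpeed ℓ Vm Vp φ w N z ≤ M * (Vp - (Vp - Vm) * weightCDF w (-z 0)) := by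
  rw [← sum_lookAhead_sub hw hN hz, Finset.mul_sum]
  exact Finset.sum_le_sum fun k hk => mul_le_mul_of_nonneg_right (hM k (Finset.mem_range.mp hk))
    (lookAhead_succ_nonneg hw hℓ hVm hV hz k)

theorem le_queueSpeed (hw : IsWeight h w) (hℓ : 0 < ℓ) (hVm : 0 < Vm) (hV : Vm < Vp)
    (hN : h ≤ N * ℓ) {z : ℕ → ℝ} (hz : ∀ k, ℓ ≤ z (k + 1) - z k) {M : ℝ}
    (hM : ∀ k < N, M ≤ gapSpeed ℓ φ (z (k + 1) - z k)) :
    M * (Vp - (Vp - Vm) * weightCDF w (-z 0)) ≤ queueSpeed ℓ Vm Vp φ w N z := by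
  rw [← sum_lookAhead_sub hw hN hz, Finset.mul_sum]
  exact Finset.sum_le_sum fun k hk => mul_le_mul_of_nonneg_right (hM k (Finset.mem_range.mp hk))
    (lookAhead_succ_nonneg hw hℓ hVm hV hz k)

theorem le_frontLimit (hw : IsWeight h w) (hV : Vm < Vp) (x : ℝ) :
    Vm ≤ Vp - (Vp - Vm) * weightCDF w (-x) := by
  have := mul_le_mul_of_nonneg_left (hw.cdf_le_one (-x)) (sub_nonneg.mpr hV.le)
  linarith

theorem frontLimit_le (hw : IsWeight h w) (hV : Vm < Vp) (x : ℝ) :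
    Vp - (Vp - Vm) * weightCDF w (-x) ≤ Vp := by
  have := mul_nonneg (sub_nonneg.mpr hV.le) (hw.cdf_nonneg (-x))
  linarith

/-- Partial summation against a nondecreasing sequence. -/
theorem le_sum_mul_sub_of_monotone {a u : ℕ → ℝ} (ha : Monotone a) (hu : ∀ k, u k ≤ 0) (n : ℕ) :
    a n * u n - a 0 * u 0 ≤ ∑ k ∈ Finset.range n, a k * (u (k + 1) - u k) := by
  induction n with
  | zero => simp
  | succ n ih =>
    rw [Finset.sum_range_succ]
    have := mul_le_mul_of_nonpos_right (ha n.le_succ) (hu (n + 1))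
    linarith

/-- If the gaps between the cars do not decrease towards the front, then the leader is at least as
fast as the follower, with an explicit margin. Both speeds are written as sums of increments of
the gap speeds, weighted by `∫_b^∞ V(y) w(y - x) dy`, which is nondecreasing in `x`. -/
theorem queueSpeed_succ_sub_ge (hφ : IsSpeedFunction φ) (hw : IsWeight h w) (hℓ : 0 < ℓ)
    (hVm : 0 < Vm) (hV : Vm < Vp) (hN : h ≤ N * ℓ) {z : ℕ → ℝ}
    (hz : ∀ k, ℓ ≤ z (k + 1) - z k) (hmono : Monotone fun k => z (k + 1) - z k) :
    (gapSpeed ℓ φ (z 2 - z 1) - gapSpeed ℓ φ (z 1 - z 0)) * (Vm * weightCDF w (z 1 - z 0)) +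
      gapSpeed ℓ φ (z 1 - z 0) * ((Vp - Vm) * (weightCDF w (-z 0) - weightCDF w (-z 1))) ≤
      queueSpeed ℓ Vm Vp φ w N (fun k => z (k + 1)) - queueSpeed ℓ Vm Vp φ w N z := by
  set g : ℕ → ℝ := fun k => gapSpeed ℓ φ (z (k + 1) - z k) with hg
  set H0 : ℕ → ℝ := fun k => lookAhead Vm Vp w (z 0) (z k) with hH0
  set H1 : ℕ → ℝ := fun k => lookAhead Vm Vp w (z 1) (z k) with hH1
  have h01 : z 0 ≤ z 1 := by linarith [hz 0]
  have hgm : Monotone g := fun i j hij => gapSpeed_monotone hφ hℓ (hmono hij)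
  have hend0 : H0 N = Vp := lookAhead_of_ge hw (by linarith [add_nat_mul_le hz N])
  have hend0' : H0 (N + 1) = Vp :=
    lookAhead_of_ge hw (by linarith [add_nat_mul_le hz N, hz N])
  have hend1 : H1 (N + 1) = Vp :=
    lookAhead_of_ge hw (by linarith [add_nat_mul_le (z := fun k => z (k + 1)) (fun k => hz _) N])
  -- Both speeds are written over the gaps `1, …, N`; for the follower, the extra gap `N` lies
  -- beyond the horizon.
  have hS : queueSpeed ℓ Vm Vp φ w N z =
      ∑ k ∈ Finset.range N, g (k + 1) * (H0 (k + 2) - H0 (k + 1)) + g 0 * (H0 1 - H0 0) := by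
    rw [← Finset.sum_range_succ' (fun k => g k * (H0 (k + 1) - H0 k)), Finset.sum_range_succ,
      hend0, hend0', sub_self, mul_zero, add_zero]
    rfl
  have hS' : queueSpeed ℓ Vm Vp φ w N (fun k => z (k + 1)) =
      ∑ k ∈ Finset.range N, g (k + 1) * (H1 (k + 2) - H1 (k + 1)) := rfl
  have habel := le_sum_mul_sub_of_monotone (a := fun k => g (k + 1))
    (u := fun k => H1 (k + 1) - H0 (k + 1)) (fun i j hij => hgm (by omega))
    (fun k => sub_nonpos.mpr (lookAhead_mono hw hVm hV h01 le_rfl)) N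
  have hsplit : ∑ k ∈ Finset.range N, g (k + 1) *
      ((H1 (k + 1 + 1) - H0 (k + 1 + 1)) - (H1 (k + 1) - H0 (k + 1))) =
      ∑ k ∈ Finset.range N, g (k + 1) * (H1 (k + 2) - H1 (k + 1)) -
        ∑ k ∈ Finset.range N, g (k + 1) * (H0 (k + 2) - H0 (k + 1)) := by
    rw [← Finset.sum_sub_distrib]
    exact Finset.sum_congr rfl fun k _ => by ring
  simp only [hsplit, hend0', hend1] at habel
  have hm1 : Vm * weightCDF w (z 1 - z 0) ≤ H0 1 - H1 1 := by
    simp only [hH0, hH1, lookAhead, sub_self]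
    rw [hw.cdf_of_nonpos (le_refl 0)]
    have := mul_le_mul_of_nonneg_left
      (hw.cdf_monotone (show max (z 1) 0 - z 1 ≤ max (z 1) 0 - z 0 by linarith))
      (sub_nonneg.mpr hV.le)
    linarith
  have e0 : H0 0 = (Vp - Vm) * weightCDF w (-z 0) := lookAhead_self hw _
  have e1 : H1 1 = (Vp - Vm) * weightCDF w (-z 1) := lookAhead_self hw _
  have hm2 := mul_le_mul_of_nonneg_left hm1 (sub_nonneg.mpr (hgm zero_le_one))
  have hfin : (g 1 - g 0) * (Vm * weightCDF w (z 1 - z 0)) + g 0 * ((Vp - Vm) *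
      (weightCDF w (-z 0) - weightCDF w (-z 1))) ≤
      queueSpeed ℓ Vm Vp φ w N (fun k => z (k + 1)) - queueSpeed ℓ Vm Vp φ w N z := by
    rw [hS, hS']
    have : (Vp - Vm) * (weightCDF w (-z 0) - weightCDF w (-z 1)) = H0 0 - H1 1 := by
      rw [e0, e1]; ring
    rw [this]
    simp only [Nat.zero_add] at habel
    nlinarith
  exact hfin

/-- If the gaps do not decrease towards the front and the first one is smaller than the second, the
leader is faster than the follower. -/
theorem queueSpeed_lt_succ_of_gap_lt (hφ : IsSpeedFunction φ) (hw : IsWeight h w) (hh : 0 < h)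
    (hℓ : 0 < ℓ) (hVm : 0 < Vm) (hV : Vm < Vp) (hN : h ≤ N * ℓ) {z : ℕ → ℝ}
    (hz : ∀ k, ℓ ≤ z (k + 1) - z k) (hmono : Monotone fun k => z (k + 1) - z k)
    (hlt : z 1 - z 0 < z 2 - z 1) :
    queueSpeed ℓ Vm Vp φ w N z < queueSpeed ℓ Vm Vp φ w N (fun k => z (k + 1)) := by
  have h1 := queueSpeed_succ_sub_ge hφ hw hℓ hVm hV hN hz hmono
  have h2 := gapSpeed_strictMonoOn hφ hℓ (mem_Ici.mpr (hz 0)) (mem_Ici.mpr (hz 1)) hlt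
  have h3 : 0 < weightCDF w (z 1 - z 0) := hw.cdf_pos hh (hℓ.trans_le (hz 0))
  have h4 := hw.cdf_monotone (show -z 1 ≤ -z 0 by linarith [hz 0])
  have h5 := mul_pos (sub_pos.mpr h2) (mul_pos hVm h3)
  have h6 := mul_nonneg (gapSpeed_nonneg hφ hℓ (z 1 - z 0))
    (mul_nonneg (sub_nonneg.mpr hV.le) (sub_nonneg.mpr h4))
  simp only [Nat.zero_add] at h5
  linarith

/-- If the gaps do not decrease towards the front and the speed limit jumps up between two cars,
the leader is faster than the follower. -/
theorem queueSpeed_lt_succ_of_jump (hφ : IsSpeedFunction φ) (hw : IsWeight h w) (hh : 0 < h)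
    (hℓ : 0 < ℓ) (hVm : 0 < Vm) (hV : Vm < Vp) (hN : h ≤ N * ℓ) {z : ℕ → ℝ}
    (hz : ∀ k, ℓ ≤ z (k + 1) - z k) (hmono : Monotone fun k => z (k + 1) - z k)
    (hgap : ℓ < z 1 - z 0) (h0 : z 0 < 0) (h1 : 0 ≤ z 1) :
    queueSpeed ℓ Vm Vp φ w N z < queueSpeed ℓ Vm Vp φ w N (fun k => z (k + 1)) := by
  have h2 := queueSpeed_succ_sub_ge hφ hw hℓ hVm hV hN hz hmono
  have h3 : 0 < gapSpeed ℓ φ (z 1 - z 0) := (gapSpeed_nonneg hφ hℓ ℓ).trans_lt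
    (gapSpeed_strictMonoOn hφ hℓ self_mem_Ici (mem_Ici.mpr hgap.le) hgap)
  have h4 : 0 < weightCDF w (-z 0) := hw.cdf_pos hh (by linarith)
  rw [hw.cdf_of_nonpos (show -z 1 ≤ 0 by linarith), sub_zero] at h2
  have h5 := mul_pos h3 (mul_pos (sub_pos.mpr hV) h4)
  have h6 := mul_nonneg (sub_nonneg.mpr (gapSpeed_monotone hφ hℓ (hmono zero_le_one)))
    (mul_nonneg hVm.le (hw.cdf_nonneg (z 1 - z 0)))
  simp only [Nat.zero_add] at h6
  linarith

end queueSpeed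

/-! ### A differential equation with advanced arguments -/

/-- A function with `Z(t) = c t` for `t ≥ 0` that satisfies
`Z'(t) = G (Z(t), Z(t + τ), Z(t + 2τ), …)` at all times. -/
structure IsAdvancedSolution (G : (ℕ → ℝ) → ℝ) (τ c : ℝ) (Z : ℝ → ℝ) : Prop where
  linear : ∀ t, 0 ≤ t → Z t = c * t
  hasDerivAt : ∀ t, HasDerivAt Z (G fun k => Z (t + k * τ)) t

theorem IsAdvancedSolution.continuous {G : (ℕ → ℝ) → ℝ} {τ c : ℝ} {Z : ℝ → ℝ}
    (hZ : IsAdvancedSolution G τ c Z) : Continuous Z :=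
  continuous_iff_continuousAt.mpr fun t => (hZ.hasDerivAt t).continuousAt

/-- If `G` is bounded and Lipschitz continuous, the equation with advanced arguments has exactly
one solution for the data `Z(t) = c t`, `t ≥ 0`. It is the fixed point of the integral operator,
which is a contraction for a norm with an exponential weight on the negative half-line: since the
arguments are advanced, the values of `Z` that enter at time `s` carry at most the weight at `s`. -/
theorem existsUnique_isAdvancedSolution {G : (ℕ → ℝ) → ℝ} {τ c K C : ℝ} (hτ : 0 ≤ τ)
    (hlip : ∀ (z z' : ℕ → ℝ) (ε : ℝ), (∀ k, |z k - z' k| ≤ ε) → |G z - G z'| ≤ K * ε)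
    (hK : 0 ≤ K) (hbd : ∀ z, |G z| ≤ C)
    (hcont : ∀ Z : ℝ → ℝ, Continuous Z → Continuous fun s => G fun k => Z (s + k * τ))
    (hc : ∀ t, 0 ≤ t → (G fun k => c * (t + k * τ)) = c) :
    ∃! Z, IsAdvancedSolution G τ c Z := by
  -- With this rate the contraction constant `K / lam` is at most `1 / 2`.
  set lam : ℝ := 2 * K + 1 with hlam
  have hlam0 : 0 < lam := by positivity
  -- `E u` is the trajectory whose deviation from `c t`, times the weight `exp (lam t)`, is `u` on
  -- `t ≤ 0`; the deviation is continued to `t ≥ 0` by a constant, which vanishes for fixed points.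
  set E : (BoundedContinuousFunction ℝ ℝ) → ℝ → ℝ := fun u t =>
    c * t + Real.exp (-(lam * min t 0)) * u (min t 0) with hE
  have hEc : ∀ u, Continuous (E u) := fun u => by simp only [hE]; fun_prop
  set R : (ℝ → ℝ) → ℝ → ℝ := fun Z s => (G fun k => Z (s + k * τ)) - c with hR
  have hRc : ∀ Z, Continuous Z → Continuous (R Z) := fun Z hZ => (hcont Z hZ).sub continuous_const
  have hRb : ∀ Z s, ‖R Z s‖ ≤ C + |c| := fun Z s =>
    (abs_sub _ _).trans (add_le_add_left (hbd _) _)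
  -- `F Z` is the weighted deviation from `c t` of the trajectory with velocity `G (Z t, …)`.
  set F : (ℝ → ℝ) → ℝ → ℝ := fun Z t =>
    Real.exp (lam * min t 0) * ∫ s in (0 : ℝ)..(min t 0), R Z s with hF
  have hFc : ∀ Z, Continuous Z → Continuous (F Z) := fun Z hZ => by
    have h1 : Continuous fun t => ∫ s in (0 : ℝ)..t, R Z s :=
      intervalIntegral.continuous_primitive (fun a b => (hRc Z hZ).intervalIntegrable a b) 0
    have h2 : Continuous fun t : ℝ => min t 0 := by fun_prop
    exact (by fun_prop : Continuous fun t : ℝ => Real.exp (lam * min t 0)).mul (h1.comp h2)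
  have hwt : ∀ m : ℝ, Real.exp (lam * m) * (-m) ≤ 1 / lam := fun m => by
    have h1 := Real.add_one_le_exp (-(lam * m))
    have h2 : Real.exp (lam * m) * Real.exp (-(lam * m)) = 1 := by
      rw [← Real.exp_add, add_neg_cancel, Real.exp_zero]
    have h3 := mul_le_mul_of_nonneg_left h1 (Real.exp_pos (lam * m)).le
    rw [le_div_iff₀ hlam0]
    nlinarith [Real.exp_pos (lam * m)]
  have hC0 : 0 ≤ C + |c| := add_nonneg ((abs_nonneg _).trans (hbd fun _ => 0)) (abs_nonneg c)
  have hFb : ∀ Z t, ‖F Z t‖ ≤ (C + |c|) * (1 / lam) := fun Z t => by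
    have hm : min t 0 ≤ 0 := min_le_right _ _
    have h1 : ‖∫ s in (0 : ℝ)..(min t 0), R Z s‖ ≤ (C + |c|) * |min t 0 - 0| :=
      intervalIntegral.norm_integral_le_of_norm_le_const fun s _ => hRb Z s
    rw [sub_zero, abs_of_nonpos hm] at h1
    rw [hF, norm_mul, Real.norm_of_nonneg (Real.exp_pos _).le]
    calc _ ≤ Real.exp (lam * min t 0) * ((C + |c|) * (-min t 0)) := by gcongr
      _ = (C + |c|) * (Real.exp (lam * min t 0) * (-min t 0)) := by ring
      _ ≤ _ := mul_le_mul_of_nonneg_left (hwt _) hC0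
  set Φ : BoundedContinuousFunction ℝ ℝ → BoundedContinuousFunction ℝ ℝ := fun u =>
    BoundedContinuousFunction.ofNormedAddCommGroup (F (E u)) (hFc _ (hEc u)) _ (hFb (E u)) with hΦ
  have hcontr : ContractingWith (1 / 2) Φ := by
    refine ⟨by norm_num, LipschitzWith.of_dist_le_mul fun u v => ?_⟩
    refine (BoundedContinuousFunction.dist_le (by positivity)).mpr fun t => ?_
    set d := dist u v with hd
    have hd0 : 0 ≤ d := dist_nonneg
    set m := min t 0 with hm
    have hm0 : m ≤ 0 := min_le_right _ _
    have hpt : ∀ s, s ≤ 0 → ‖R (E u) s - R (E v) s‖ ≤ K * (Real.exp (-(lam * s)) * d) := by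
      intro s hs
      have : R (E u) s - R (E v) s =
          (G fun k => E u (s + k * τ)) - G fun k => E v (s + k * τ) := by simp only [hR]; ring
      rw [this]
      refine hlip _ _ _ fun k => ?_
      have hsk : s ≤ min (s + k * τ) 0 := le_min (by
        have : 0 ≤ k * τ := by positivity
        linarith) hs
      have : E u (s + k * τ) - E v (s + k * τ) = Real.exp (-(lam * min (s + k * τ) 0)) *
          (u (min (s + k * τ) 0) - v (min (s + k * τ) 0)) := by simp only [hE]; ring
      rw [this, abs_mul, abs_of_pos (Real.exp_pos _)]
      gcongr
      rw [← Real.dist_eq]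
      exact BoundedContinuousFunction.dist_coe_le_dist _
    have hint : ‖∫ s in m..0, (R (E u) s - R (E v) s)‖ ≤
        ∫ s in m..0, K * (Real.exp (-(lam * s)) * d) :=
      intervalIntegral.norm_integral_le_of_norm_le hm0
        (ae_of_all _ fun s hs => hpt s hs.2)
        ((by fun_prop : Continuous fun s => K * (Real.exp (-(lam * s)) * d)).intervalIntegrable _ _)
    have hprim : ∫ s in m..0, K * (Real.exp (-(lam * s)) * d) =
        K * d / lam * (Real.exp (-(lam * m)) - 1) := by
      have hder : ∀ s : ℝ, HasDerivAt (fun s => -(K * d / lam) * Real.exp (-(lam * s)))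
          (K * (Real.exp (-(lam * s)) * d)) s := fun s => by
        have h1 : HasDerivAt (fun s : ℝ => -(lam * s)) (-(lam * 1)) s :=
          ((hasDerivAt_id s).const_mul lam).neg
        refine (h1.exp.const_mul (-(K * d / lam))).congr_deriv ?_
        field_simp
      rw [intervalIntegral.integral_eq_sub_of_hasDerivAt (fun s _ => hder s)
        ((by fun_prop : Continuous fun s =>
          K * (Real.exp (-(lam * s)) * d)).intervalIntegrable _ _)]
      simp
      ring
    have hdist : dist (Φ u t) (Φ v t) =
        Real.exp (lam * m) * ‖∫ s in m..0, (R (E u) s - R (E v) s)‖ := by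
      have hi := fun u => (hRc _ (hEc u)).intervalIntegrable (μ := volume) m 0
      rw [intervalIntegral.integral_sub (hi u) (hi v), Real.dist_eq]
      change |F (E u) t - F (E v) t| = _
      simp only [hF]
      rw [← hm, ← mul_sub, abs_mul, abs_of_pos (Real.exp_pos _),
        intervalIntegral.integral_symm m 0, intervalIntegral.integral_symm m 0, Real.norm_eq_abs,
        ← abs_neg (_ - _)]
      congr 2
      ring
    rw [hdist]
    have hexp : Real.exp (lam * m) * Real.exp (-(lam * m)) = 1 := by
      rw [← Real.exp_add, add_neg_cancel, Real.exp_zero]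
    have hKl : K / lam ≤ 1 / 2 := by
      rw [div_le_iff₀ hlam0, hlam]; linarith
    calc Real.exp (lam * m) * ‖∫ s in m..0, (R (E u) s - R (E v) s)‖
        ≤ Real.exp (lam * m) * (K * d / lam * (Real.exp (-(lam * m)) - 1)) := by
          rw [← hprim]; gcongr
      _ = K / lam * d * (Real.exp (lam * m) * Real.exp (-(lam * m)) - Real.exp (lam * m)) := by
          ring
      _ ≤ K / lam * d * 1 := by
          rw [hexp]
          have := Real.exp_pos (lam * m)
          gcongr
          linarith
      _ ≤ ((1 / 2 : NNReal) : ℝ) * d := by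
          rw [mul_one]
          push_cast
          gcongr
  -- A solution is recovered from its integral equation, and conversely.
  have hsolve : ∀ Z, Continuous Z → (∀ t, 0 ≤ t → Z t = c * t) →
      (∀ t, t ≤ 0 → Z t = c * t + ∫ s in (0 : ℝ)..t, R Z s) → IsAdvancedSolution G τ c Z := by
    intro Z hZ h0 hneg
    have hall : ∀ t, Z t = c * t + ∫ s in (0 : ℝ)..t, R Z s := fun t => by
      rcases le_total t 0 with ht | ht
      · exact hneg t ht
      · rw [intervalIntegral.integral_congr (g := fun _ => 0) fun s hs => ?_]
        · simp [h0 t ht]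
        · rw [uIcc_of_le ht] at hs
          have : (fun k : ℕ => Z (s + k * τ)) = fun k : ℕ => c * (s + k * τ) :=
            funext fun k => h0 _ (add_nonneg hs.1 (by positivity))
          simp only [hR]
          rw [this, hc s hs.1, sub_self]
    refine ⟨h0, fun t => ?_⟩
    have h1 : HasDerivAt (fun t => c * t + ∫ s in (0 : ℝ)..t, R Z s) (c * 1 + R Z t) t :=
      ((hasDerivAt_id t).const_mul c).add (intervalIntegral.integral_hasDerivAt_right
        ((hRc Z hZ).intervalIntegrable _ _) ((hRc Z hZ).stronglyMeasurableAtFilter _ _)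
        (hRc Z hZ).continuousAt)
    rw [← funext hall] at h1
    refine h1.congr_deriv ?_
    simp only [hR]
    ring
  have hEF : ∀ Z, Continuous Z → (∀ t, 0 ≤ t → Z t = c * t) →
      (∀ t, t ≤ 0 → Z t = c * t + ∫ s in (0 : ℝ)..t, R Z s) →
      ∀ t, Z t = c * t + Real.exp (-(lam * min t 0)) * F Z (min t 0) := by
    intro Z hZ h0 hneg t
    have hexp : Real.exp (-(lam * min t 0)) * Real.exp (lam * min t 0) = 1 := by
      rw [← Real.exp_add, neg_add_cancel, Real.exp_zero]
    simp only [hF]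
    rw [min_eq_left (min_le_right t 0), ← mul_assoc, hexp, one_mul]
    rcases le_total t 0 with ht | ht
    · rw [min_eq_left ht, hneg t ht]
    · rw [min_eq_right ht, h0 t ht]
      simp
  set u₀ := hcontr.fixedPoint with hu₀
  have hfix : Φ u₀ = u₀ := hcontr.fixedPoint_isFixedPt
  have hfix' : ∀ t, u₀ t = F (E u₀) t := fun t => by
    conv_lhs => rw [← hfix]
    rfl
  refine ⟨E u₀, hsolve _ (hEc _) (fun t ht => ?_) (fun t ht => ?_), fun Z hZ => ?_⟩
  · simp only [hE]
    rw [hfix', min_eq_right ht]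
    simp [hF]
  · have hexp : Real.exp (-(lam * t)) * Real.exp (lam * t) = 1 := by
      rw [← Real.exp_add, neg_add_cancel, Real.exp_zero]
    conv_lhs => simp only [hE]
    rw [hfix', min_eq_left ht]
    simp only [hF]
    rw [min_eq_left ht, ← mul_assoc, hexp, one_mul]
  · have hZc := hZ.continuous
    have hint : ∀ t, t ≤ 0 → Z t = c * t + ∫ s in (0 : ℝ)..t, R Z s := fun t _ => by
      have h1 : ∫ s in (0 : ℝ)..t, (G fun k => Z (s + k * τ)) = Z t - Z 0 :=
        intervalIntegral.integral_eq_sub_of_hasDerivAt (fun s _ => hZ.hasDerivAt s)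
          ((hcont Z hZc).intervalIntegrable _ _)
      simp only [hR]
      rw [intervalIntegral.integral_sub ((hcont Z hZc).intervalIntegrable _ _)
        (by simp), h1, hZ.linear 0 le_rfl]
      simp
      ring
    set v : BoundedContinuousFunction ℝ ℝ :=
      BoundedContinuousFunction.ofNormedAddCommGroup (F Z) (hFc _ hZc) _ (hFb Z) with hv
    have hEv : E v = Z := funext fun t => (hEF Z hZc hZ.linear hint t).symm
    have hvfix : Φ v = v := by
      ext t
      change F (E v) t = F Z t
      rw [hEv]
    rw [← hEv, hcontr.fixedPoint_unique hvfix]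

/-! ### Standing assumptions -/

/-- The assumptions on the data of the problem. Here `c` is the speed of free flow at density `ρp`
on `x ≥ 0`, the number `τ` is the time in which `c` covers the corresponding distance `ℓ / ρp`
between two cars, and `N` is a number of leaders that certainly reaches the horizon `h`. -/
structure StationarySetup (ℓ h Vm Vp ρm ρp ρhat τ c : ℝ) (N : ℕ) (φ w : ℝ → ℝ) : Prop where
  ℓ_pos : 0 < ℓ
  h_pos : 0 < h
  weight : IsWeight h w
  speed : IsSpeedFunction φ
  Vm_pos : 0 < Vm
  Vm_lt : Vm < Vp
  ρhat_mem : ρhat ∈ Icc (0 : ℝ) 1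
  stagnation : derivWithin (fluxFn φ) (Icc 0 1) ρhat = 0
  ρp_pos : 0 < ρp
  ρp_lt : ρp < ρm
  ρm_le : ρm ≤ ρhat
  flux_eq : Vm * fluxFn φ ρm = Vp * fluxFn φ ρp
  c_eq : c = Vp * φ ρp
  τ_eq : τ = ℓ / (ρp * c)
  h_le : h ≤ N * ℓ

namespace StationarySetup

variable {ℓ h Vm Vp ρm ρp ρhat τ c : ℝ} {N : ℕ} {φ w : ℝ → ℝ}

theorem Vp_pos (S : StationarySetup ℓ h Vm Vp ρm ρp ρhat τ c N φ w) : 0 < Vp :=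
  S.Vm_pos.trans S.Vm_lt

theorem ρm_lt_one (S : StationarySetup ℓ h Vm Vp ρm ρp ρhat τ c N φ w) : ρm < 1 :=
  S.ρm_le.trans_lt (S.speed.stagnation_lt_one S.ρhat_mem S.stagnation)

theorem ρm_pos (S : StationarySetup ℓ h Vm Vp ρm ρp ρhat τ c N φ w) : 0 < ρm :=
  S.ρp_pos.trans S.ρp_lt

theorem ρp_lt_one (S : StationarySetup ℓ h Vm Vp ρm ρp ρhat τ c N φ w) : ρp < 1 :=
  S.ρp_lt.trans S.ρm_lt_one

theorem c_pos (S : StationarySetup ℓ h Vm Vp ρm ρp ρhat τ c N φ w) : 0 < c := by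
  rw [S.c_eq]
  exact mul_pos S.Vp_pos (S.speed.pos S.ρp_pos.le S.ρp_lt_one)

theorem τ_pos (S : StationarySetup ℓ h Vm Vp ρm ρp ρhat τ c N φ w) : 0 < τ := by
  rw [S.τ_eq]
  exact div_pos S.ℓ_pos (mul_pos S.ρp_pos S.c_pos)

theorem c_mul_τ (S : StationarySetup ℓ h Vm Vp ρm ρp ρhat τ c N φ w) : c * τ = ℓ / ρp := by
  have h1 := S.ρp_pos
  have h2 := S.c_pos
  rw [S.τ_eq]
  field_simp

theorem τ_mul_flux (S : StationarySetup ℓ h Vm Vp ρm ρp ρhat τ c N φ w) :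
    τ * (Vp * fluxFn φ ρp) = ℓ := by
  have h1 : Vp * fluxFn φ ρp = ρp * c := by rw [S.c_eq, fluxFn]; ring
  have h2 := mul_pos S.ρp_pos S.c_pos
  rw [h1, S.τ_eq, div_mul_cancel₀ _ h2.ne']

theorem τ_mul_Vm (S : StationarySetup ℓ h Vm Vp ρm ρp ρhat τ c N φ w) :
    τ * (Vm * φ ρm) = ℓ / ρm := by
  rw [eq_div_iff S.ρm_pos.ne', ← S.τ_mul_flux, ← S.flux_eq, fluxFn]
  ring

theorem ℓ_lt_div (S : StationarySetup ℓ h Vm Vp ρm ρp ρhat τ c N φ w) : ℓ < ℓ / ρm := by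
  rw [lt_div_iff₀ S.ρm_pos]
  exact mul_lt_of_lt_one_right S.ℓ_pos S.ρm_lt_one

theorem div_lt_div (S : StationarySetup ℓ h Vm Vp ρm ρp ρhat τ c N φ w) : ℓ / ρm < ℓ / ρp :=
  div_lt_div_of_pos_left S.ℓ_pos S.ρp_pos S.ρp_lt

theorem strictMonoOn_flux (S : StationarySetup ℓ h Vm Vp ρm ρp ρhat τ c N φ w) :
    StrictMonoOn (fluxFn φ) (Icc 0 ρhat) :=
  S.speed.strictMonoOn_fluxFn S.ρhat_mem S.stagnation

/-- Equally spaced cars of density `ρp` on `x ≥ 0` move with speed `c`. -/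
theorem queueSpeed_linear (S : StationarySetup ℓ h Vm Vp ρm ρp ρhat τ c N φ w) {t : ℝ}
    (ht : 0 ≤ t) : queueSpeed ℓ Vm Vp φ w N (fun k => c * (t + k * τ)) = c := by
  have hgap : ∀ k : ℕ, c * (t + (k + 1 : ℕ) * τ) - c * (t + k * τ) = ℓ / ρp := fun k => by
    rw [← S.c_mul_τ]; push_cast; ring
  have hz : ∀ k : ℕ, ℓ ≤ c * (t + (k + 1 : ℕ) * τ) - c * (t + k * τ) := fun k => by
    rw [hgap]; exact (S.ℓ_lt_div.trans S.div_lt_div).le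
  have hg : ∀ k : ℕ, gapSpeed ℓ φ (c * (t + (k + 1 : ℕ) * τ) - c * (t + k * τ)) = φ ρp :=
    fun k => by rw [hgap, gapSpeed_div S.ℓ_pos S.ρp_pos S.ρp_lt_one.le]
  have h1 := queueSpeed_le (z := fun k : ℕ => c * (t + k * τ)) S.weight S.ℓ_pos S.Vm_pos S.Vm_lt
    S.h_le hz fun k _ => (hg k).le
  have h2 := le_queueSpeed (z := fun k : ℕ => c * (t + k * τ)) S.weight S.ℓ_pos S.Vm_pos S.Vm_lt
    S.h_le hz fun k _ => (hg k).ge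
  have h0 : -(c * (t + ((0 : ℕ) : ℝ) * τ)) ≤ 0 := by
    have := mul_nonneg S.c_pos.le ht
    simpa
  rw [S.weight.cdf_of_nonpos h0, mul_zero, sub_zero, mul_comm, ← S.c_eq] at h1 h2
  exact le_antisymm h1 h2

end StationarySetup

/-! ### The trajectory of the stationary wave -/

/-- The distance `Z(t + τ) - Z(t)` to the leader along a trajectory in which every car repeats the
motion of its leader with delay `τ`. -/
def gapAlong (τ : ℝ) (Z : ℝ → ℝ) (t : ℝ) : ℝ := Z (t + τ) - Z t

/-- The averaged speed at time `t` along a trajectory in which every car repeats the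
motion of its leader with delay `τ`. -/
def speedAlong (ℓ Vm Vp : ℝ) (φ w : ℝ → ℝ) (N : ℕ) (τ : ℝ) (Z : ℝ → ℝ) (t : ℝ) : ℝ :=
  queueSpeed ℓ Vm Vp φ w N fun k => Z (t + k * τ)

theorem exists_gt_of_hasDerivAt_pos {f : ℝ → ℝ} {f' a b : ℝ} (hf : HasDerivAt f f' a)
    (hf' : 0 < f') (hab : a < b) : ∃ x ∈ Ioo a b, f a < f x := by
  have h1 : Tendsto (slope f a) (𝓝[>] a) (𝓝 f') :=
    (hasDerivWithinAt_iff_tendsto_slope' self_notMem_Ioi).mp hf.hasDerivWithinAt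
  obtain ⟨x, hx, hx'⟩ := ((h1.eventually (lt_mem_nhds hf')).and (Ioo_mem_nhdsGT hab)).exists
  refine ⟨x, hx', ?_⟩
  rw [slope_def_field, div_pos_iff_of_pos_right (sub_pos.mpr hx'.1)] at hx
  linarith

theorem tendsto_of_le_deriv {f f' : ℝ → ℝ} {v : ℝ} (hv : 0 < v)
    (hf : ∀ x, HasDerivAt f (f' x) x) (hf' : ∀ x, v ≤ f' x) :
    Tendsto f atTop atTop ∧ Tendsto f atBot atBot := by
  have hmono : Monotone fun x => f x - v * x := by
    refine monotone_of_hasDerivAt_nonneg (f' := fun x => f' x - v * 1)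
      (fun x => (hf x).sub ((hasDerivAt_id x).const_mul v)) fun x => ?_
    have := hf' x
    simp only [Pi.zero_apply]
    linarith
  have htop : Tendsto (fun x => f 0 + v * x) atTop atTop :=
    tendsto_atTop_add_const_left _ _ (tendsto_id.const_mul_atTop hv)
  have hbot : Tendsto (fun x => f 0 + v * x) atBot atBot :=
    tendsto_atBot_add_const_left _ _ (tendsto_id.const_mul_atBot hv)
  refine ⟨tendsto_atTop_mono' _ ?_ htop, tendsto_atBot_mono' _ ?_ hbot⟩
  · filter_upwards [eventually_ge_atTop 0] with x hx
    have := hmono hx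
    simp only [mul_zero, sub_zero] at this
    linarith
  · filter_upwards [eventually_le_atBot 0] with x hx
    have := hmono hx
    simp only [mul_zero, sub_zero] at this
    linarith

namespace StationarySetup

variable {ℓ h Vm Vp ρm ρp ρhat τ c : ℝ} {N : ℕ} {φ w : ℝ → ℝ} {Z : ℝ → ℝ}

theorem existsUnique_trajectory (S : StationarySetup ℓ h Vm Vp ρm ρp ρhat τ c N φ w) :
    ∃! Z, IsAdvancedSolution (queueSpeed ℓ Vm Vp φ w N) τ c Z := by
  obtain ⟨K, hK, hlip⟩ :=
    queueSpeed_exists_lipschitz (N := N) S.speed S.weight S.ℓ_pos S.Vm_pos S.Vm_lt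
  exact existsUnique_isAdvancedSolution S.τ_pos.le hlip hK
    (abs_queueSpeed_le S.speed S.weight S.ℓ_pos S.Vm_pos S.Vm_lt)
    (fun Z hZ => queueSpeed_continuous S.speed S.weight S.ℓ_pos fun k => by fun_prop)
    (fun t ht => S.queueSpeed_linear ht)

theorem hasDerivAt_trajectory
    (hZ : IsAdvancedSolution (queueSpeed ℓ Vm Vp φ w N) τ c Z) (t : ℝ) :
    HasDerivAt Z (speedAlong ℓ Vm Vp φ w N τ Z t) t :=
  hZ.hasDerivAt t

theorem continuous_speedAlong (S : StationarySetup ℓ h Vm Vp ρm ρp ρhat τ c N φ w)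
    (hZ : IsAdvancedSolution (queueSpeed ℓ Vm Vp φ w N) τ c Z) :
    Continuous (speedAlong ℓ Vm Vp φ w N τ Z) := by
  have := hZ.continuous
  exact queueSpeed_continuous S.speed S.weight S.ℓ_pos fun k => by fun_prop

theorem continuous_gapAlong (hZ : IsAdvancedSolution (queueSpeed ℓ Vm Vp φ w N) τ c Z) :
    Continuous (gapAlong τ Z) := by
  have := hZ.continuous
  unfold gapAlong
  fun_prop

theorem hasDerivAt_gapAlong (hZ : IsAdvancedSolution (queueSpeed ℓ Vm Vp φ w N) τ c Z) (t : ℝ) :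
    HasDerivAt (gapAlong τ Z)
      (speedAlong ℓ Vm Vp φ w N τ Z (t + τ) - speedAlong ℓ Vm Vp φ w N τ Z t) t :=
  ((hasDerivAt_trajectory hZ (t + τ)).comp_add_const t τ).sub (hasDerivAt_trajectory hZ t)

theorem speedAlong_of_nonneg (S : StationarySetup ℓ h Vm Vp ρm ρp ρhat τ c N φ w)
    (hZ : IsAdvancedSolution (queueSpeed ℓ Vm Vp φ w N) τ c Z) {t : ℝ} (ht : 0 ≤ t) :
    speedAlong ℓ Vm Vp φ w N τ Z t = c := by
  have hτ := S.τ_pos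
  have : (fun k : ℕ => Z (t + k * τ)) = fun k : ℕ => c * (t + k * τ) :=
    funext fun k => hZ.linear _ (by positivity)
  rw [speedAlong, this, S.queueSpeed_linear ht]

theorem gapAlong_of_nonneg (S : StationarySetup ℓ h Vm Vp ρm ρp ρhat τ c N φ w)
    (hZ : IsAdvancedSolution (queueSpeed ℓ Vm Vp φ w N) τ c Z) {t : ℝ} (ht : 0 ≤ t) :
    gapAlong τ Z t = ℓ / ρp := by
  have hτ := S.τ_pos
  rw [gapAlong, hZ.linear _ ht, hZ.linear _ (by positivity), ← S.c_mul_τ]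
  ring

theorem gap_eq_gapAlong (τ : ℝ) (Z : ℝ → ℝ) (t : ℝ) (k : ℕ) :
    Z (t + (k + 1 : ℕ) * τ) - Z (t + k * τ) = gapAlong τ Z (t + k * τ) := by
  rw [gapAlong]
  push_cast
  ring_nf

theorem speedAlong_add (t : ℝ) : speedAlong ℓ Vm Vp φ w N τ Z (t + τ) =
    queueSpeed ℓ Vm Vp φ w N fun k => Z (t + (k + 1 : ℕ) * τ) := by
  unfold speedAlong
  congr 1
  funext k
  push_cast
  ring_nf

/-- Just to the left of time `0` the gap is at most its value `ℓ / ρp` at time `0`. Otherwise the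
product of the excess with a suitable exponential would have a positive maximum, where its
derivative is positive, because an excess gap lets a car exceed the speed `c` at most proportionally. -/
theorem gapAlong_le_of_neg_period_le (S : StationarySetup ℓ h Vm Vp ρm ρp ρhat τ c N φ w)
    (hZ : IsAdvancedSolution (queueSpeed ℓ Vm Vp φ w N) τ c Z) {t : ℝ} (ht : -τ ≤ t)
    (ht0 : t ≤ 0) : gapAlong τ Z t ≤ ℓ / ρp := by
  by_contra! hgt
  have hτ := S.τ_pos
  obtain ⟨K, hK, hlip⟩ := gapSpeed_exists_lipschitz S.speed S.ℓ_pos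
  -- The excess gap `u` satisfies `u' ≥ -K Vp u` where it is positive, so `exp (κ t) u` increases.
  set κ := K * Vp + 1
  set F : ℝ → ℝ := fun t => Real.exp (κ * t) * (gapAlong τ Z t - ℓ / ρp) with hF
  have hFc : Continuous F := by
    have := continuous_gapAlong hZ
    fun_prop
  obtain ⟨r, ⟨hr1, hr2⟩, hmax⟩ := isCompact_Icc.exists_isMaxOn
    (nonempty_Icc.mpr (neg_nonpos.mpr hτ.le)) hFc.continuousOn
  have hFr : 0 < F r := (mul_pos (Real.exp_pos _) (sub_pos.mpr hgt)).trans_le (hmax ⟨ht, ht0⟩)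
  have hu : 0 < gapAlong τ Z r - ℓ / ρp := (pos_iff_pos_of_mul_pos hFr).mp (Real.exp_pos _)
  have hr0 : r < 0 := lt_of_le_of_ne hr2 fun h0 => by
    rw [S.gapAlong_of_nonneg hZ h0.ge, sub_self] at hu
    exact hu.false
  have hℓρ := (S.ℓ_lt_div.trans S.div_lt_div).le
  have hgaps : ∀ k : ℕ, k ≠ 0 → gapAlong τ Z (r + k * τ) = ℓ / ρp := fun k hk => by
    refine S.gapAlong_of_nonneg hZ ?_
    have : (1 : ℝ) ≤ k := by exact_mod_cast Nat.one_le_iff_ne_zero.mpr hk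
    nlinarith
  have hgaps' : ∀ k : ℕ, ℓ / ρp ≤ gapAlong τ Z (r + k * τ) ∧
      gapAlong τ Z (r + k * τ) - ℓ / ρp ≤ gapAlong τ Z r - ℓ / ρp := fun k => by
    rcases eq_or_ne k 0 with rfl | hk
    · simpa using hu.le
    · rw [hgaps k hk]
      exact ⟨le_rfl, by linarith⟩
  have hs : speedAlong ℓ Vm Vp φ w N τ Z r ≤ c + K * (gapAlong τ Z r - ℓ / ρp) * Vp := by
    have h1 := queueSpeed_le (φ := φ) (M := φ ρp + K * (gapAlong τ Z r - ℓ / ρp))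
      S.weight S.ℓ_pos S.Vm_pos S.Vm_lt S.h_le
      (z := fun k => Z (r + k * τ)) (fun k => by
        rw [gap_eq_gapAlong]; exact hℓρ.trans (hgaps' k).1) (fun k _ => by
        rw [gap_eq_gapAlong]
        have h2 := hlip (gapAlong τ Z (r + k * τ)) (ℓ / ρp)
        rw [gapSpeed_div S.ℓ_pos S.ρp_pos S.ρp_lt_one.le,
          abs_of_nonneg (sub_nonneg.mpr (hgaps' k).1)] at h2
        have h3 := mul_le_mul_of_nonneg_left (hgaps' k).2 hK
        linarith [(abs_le.mp h2).2])
    refine h1.trans ((mul_le_mul_of_nonneg_left (frontLimit_le S.weight S.Vm_lt _) ?_).trans_eq ?_)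
    · exact add_nonneg (S.speed.pos S.ρp_pos.le S.ρp_lt_one).le (mul_nonneg hK hu.le)
    · rw [S.c_eq]; ring
  have hder : HasDerivAt F (Real.exp (κ * r) * (κ * 1) * (gapAlong τ Z r - ℓ / ρp) +
      Real.exp (κ * r) * (speedAlong ℓ Vm Vp φ w N τ Z (r + τ) -
        speedAlong ℓ Vm Vp φ w N τ Z r)) r :=
    (((hasDerivAt_id r).const_mul κ).exp).mul ((hasDerivAt_gapAlong hZ r).sub_const _)
  obtain ⟨x, hx, hlt⟩ := exists_gt_of_hasDerivAt_pos hder (by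
    rw [S.speedAlong_of_nonneg hZ (t := r + τ) (by linarith), mul_assoc, ← mul_add]
    refine mul_pos (Real.exp_pos _) ?_
    simp only [κ]
    linarith) hr0
  exact hlt.not_ge (hmax ⟨hr1.trans hx.1.le, hx.2.le⟩)

theorem gaps_of_monotoneOn (hτ : 0 < τ) {t : ℝ} (hm : MonotoneOn (gapAlong τ Z) (Ici t))
    (hg : ℓ ≤ gapAlong τ Z t) :
    (∀ k : ℕ, ℓ ≤ Z (t + (k + 1 : ℕ) * τ) - Z (t + k * τ)) ∧
      Monotone fun k : ℕ => Z (t + (k + 1 : ℕ) * τ) - Z (t + k * τ) := by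
  have hk : ∀ k : ℕ, t ≤ t + k * τ := fun k => by
    have : 0 ≤ k * τ := by positivity
    linarith
  refine ⟨fun k => ?_, fun i j hij => ?_⟩
  · rw [gap_eq_gapAlong]
    exact hg.trans (hm self_mem_Ici (hk k) (hk k))
  · simp only [gap_eq_gapAlong]
    refine hm (hk i) (hk j) ?_
    gcongr

theorem le_speedAlong (S : StationarySetup ℓ h Vm Vp ρm ρp ρhat τ c N φ w) {t : ℝ}
    (hm : MonotoneOn (gapAlong τ Z) (Ici t)) (hg : ℓ ≤ gapAlong τ Z t) :
    Vm * gapSpeed ℓ φ (gapAlong τ Z t) ≤ speedAlong ℓ Vm Vp φ w N τ Z t := by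
  obtain ⟨h1, h2⟩ := gaps_of_monotoneOn S.τ_pos hm hg
  have h3 := le_queueSpeed (φ := φ) (M := gapSpeed ℓ φ (gapAlong τ Z t)) S.weight S.ℓ_pos S.Vm_pos
    S.Vm_lt S.h_le (z := fun k => Z (t + k * τ)) h1
    (fun k _ => gapSpeed_monotone S.speed S.ℓ_pos (by
      rw [gap_eq_gapAlong]
      have : 0 ≤ k * τ := by have := S.τ_pos; positivity
      exact hm self_mem_Ici (mem_Ici.mpr (by linarith)) (by linarith)))
  refine le_trans ?_ h3
  rw [mul_comm]
  exact mul_le_mul_of_nonneg_left (le_frontLimit S.weight S.Vm_lt _)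
    (gapSpeed_nonneg S.speed S.ℓ_pos _)

/-- Going back in time from `0`, the gap stays above `ℓ / ρm` and every car stays slower than its
leader. At the last time at which this fails, the gap would be nondecreasing from there on, so that
the comparison of the speeds and the mean speed over one period exclude both ways to fail. -/
theorem lt_gapAlong_and_speedAlong_lt (S : StationarySetup ℓ h Vm Vp ρm ρp ρhat τ c N φ w)
    (hZ : IsAdvancedSolution (queueSpeed ℓ Vm Vp φ w N) τ c Z) {t : ℝ} (ht : t < 0) :
    ℓ / ρm < gapAlong τ Z t ∧
      speedAlong ℓ Vm Vp φ w N τ Z t < speedAlong ℓ Vm Vp φ w N τ Z (t + τ) := by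
  have hτ := S.τ_pos
  have hsc := S.continuous_speedAlong hZ
  have hDc := continuous_gapAlong hZ
  obtain ⟨δ, hδ, hδτ, hnear⟩ : ∃ δ, 0 < δ ∧ δ ≤ τ ∧ ∀ r, -δ < r → r ≤ 0 →
      ℓ / ρm < gapAlong τ Z r ∧ 0 < speedAlong ℓ Vm Vp φ w N τ Z r := by
    have h1 : ∀ᶠ r in 𝓝 (0 : ℝ), ℓ / ρm < gapAlong τ Z r :=
      hDc.continuousAt.eventually (lt_mem_nhds (by
        rw [S.gapAlong_of_nonneg hZ le_rfl]; exact S.div_lt_div))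
    have h2 : ∀ᶠ r in 𝓝 (0 : ℝ), 0 < speedAlong ℓ Vm Vp φ w N τ Z r :=
      hsc.continuousAt.eventually (lt_mem_nhds (by
        rw [S.speedAlong_of_nonneg hZ le_rfl]; exact S.c_pos))
    obtain ⟨ε, hε, hball⟩ := Metric.eventually_nhds_iff.mp (h1.and h2)
    refine ⟨min ε τ, lt_min hε hτ, min_le_right _ _, fun r hr hr0 => hball ?_⟩
    rw [Real.dist_eq, sub_zero, abs_of_nonpos hr0]
    linarith [min_le_left ε τ]
  -- Close to time `0`, the leader is already on `x ≥ 0`, and the jump of the speed limit decides.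
  have hgood : ∀ r, -δ < r → r < 0 → ℓ / ρm < gapAlong τ Z r ∧
      speedAlong ℓ Vm Vp φ w N τ Z r < speedAlong ℓ Vm Vp φ w N τ Z (r + τ) := by
    intro r hr hr0
    refine ⟨(hnear r hr hr0.le).1, ?_⟩
    have hle : gapAlong τ Z r ≤ ℓ / ρp := S.gapAlong_le_of_neg_period_le hZ (by linarith) hr0.le
    have hgaps : ∀ k : ℕ, k ≠ 0 → gapAlong τ Z (r + k * τ) = ℓ / ρp := fun k hk => by
      refine S.gapAlong_of_nonneg hZ ?_
      have : (1 : ℝ) ≤ k := by exact_mod_cast Nat.one_le_iff_ne_zero.mpr hk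
      nlinarith
    have hℓD := S.ℓ_lt_div.trans (hnear r hr hr0.le).1
    have hZr : Z r < 0 := by
      have hmono : StrictMonoOn Z (Icc r 0) := by
        refine strictMonoOn_of_deriv_pos (convex_Icc r 0) hZ.continuous.continuousOn fun x hx => ?_
        rw [interior_Icc] at hx
        rw [(hasDerivAt_trajectory hZ x).deriv]
        exact (hnear x (hr.trans hx.1) hx.2.le).2
      have := hmono (left_mem_Icc.mpr hr0.le) (right_mem_Icc.mpr hr0.le) hr0
      rwa [hZ.linear 0 le_rfl, mul_zero] at this
    rw [speedAlong_add]
    refine queueSpeed_lt_succ_of_jump S.speed S.weight S.h_pos S.ℓ_pos S.Vm_pos S.Vm_lt S.h_le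
      (z := fun k => Z (r + k * τ)) (fun k => ?_) (monotone_nat_of_le_succ fun k => ?_) ?_ ?_ ?_
    · rw [gap_eq_gapAlong]
      rcases eq_or_ne k 0 with rfl | hk
      · simpa using hℓD.le
      · rw [hgaps k hk]
        exact (S.ℓ_lt_div.trans S.div_lt_div).le
    · rw [gap_eq_gapAlong, gap_eq_gapAlong, hgaps (k + 1) (by omega)]
      rcases eq_or_ne k 0 with rfl | hk
      · simpa using hle
      · exact (hgaps k hk).le
    · simpa [gapAlong] using hℓD
    · simpa using hZr
    · simp only [Nat.cast_one, one_mul]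
      rw [hZ.linear _ (by linarith)]
      exact mul_nonneg S.c_pos.le (by linarith)
  by_contra hbad
  -- The bound `-(δ / 2)` keeps the set of failures closed; by `hgood` it excludes none of them.
  set B : Set ℝ := {r | r ≤ -(δ / 2)} ∩ ({r | gapAlong τ Z r ≤ ℓ / ρm} ∪
    {r | speedAlong ℓ Vm Vp φ w N τ Z (r + τ) ≤ speedAlong ℓ Vm Vp φ w N τ Z r}) with hB
  have hBc : IsClosed B :=
    isClosed_Iic.inter ((isClosed_le hDc continuous_const).union
      (isClosed_le (hsc.comp (continuous_add_const τ)) hsc))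
  have hBb : BddAbove B := ⟨_, fun r hr => hr.1⟩
  have hBn : B.Nonempty := by
    refine ⟨t, ?_, ?_⟩
    · by_contra hlt
      simp only [mem_ofPred_eq, not_le] at hlt
      exact hbad (hgood t (by linarith) ht)
    · by_contra hn
      simp only [mem_union, mem_ofPred_eq, not_or, not_le] at hn
      exact hbad hn
  set r := sSup B with hr
  have hrB : r ∈ B := hBc.csSup_mem hBn hBb
  have hr0 : r < 0 := lt_of_le_of_lt hrB.1 (by linarith)
  have hafter : ∀ x, r < x → x < 0 → ℓ / ρm < gapAlong τ Z x ∧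
      speedAlong ℓ Vm Vp φ w N τ Z x < speedAlong ℓ Vm Vp φ w N τ Z (x + τ) := by
    intro x hx hx0
    by_cases hxδ : -δ < x
    · exact hgood x hxδ hx0
    · by_contra hn
      rw [not_and_or, not_lt, not_lt] at hn
      exact hx.not_ge (le_csSup hBb ⟨by simp only [mem_ofPred_eq]; linarith, hn⟩)
  have hstrict : StrictMonoOn (gapAlong τ Z) (Icc r 0) := by
    refine strictMonoOn_of_deriv_pos (convex_Icc r 0) hDc.continuousOn fun x hx => ?_
    rw [interior_Icc] at hx
    rw [(hasDerivAt_gapAlong hZ x).deriv]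
    linarith [(hafter x hx.1 hx.2).2]
  have hmin : ∀ x, gapAlong τ Z x = gapAlong τ Z (min x 0) := fun x => by
    rcases le_total x 0 with hx | hx
    · rw [min_eq_left hx]
    · rw [min_eq_right hx, S.gapAlong_of_nonneg hZ hx, S.gapAlong_of_nonneg hZ le_rfl]
  have hmono : MonotoneOn (gapAlong τ Z) (Ici r) := fun x hx y hy hxy => by
    rw [hmin x, hmin y]
    exact hstrict.monotoneOn ⟨le_min hx hr0.le, min_le_right _ _⟩
      ⟨le_min hy hr0.le, min_le_right _ _⟩ (min_le_min_right _ hxy)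
  have hlt : ∀ x, r < x → gapAlong τ Z r < gapAlong τ Z x := fun x hx => by
    rw [hmin x]
    exact hstrict (left_mem_Icc.mpr hr0.le) ⟨le_min hx.le hr0.le, min_le_right _ _⟩
      (lt_min hx hr0)
  have hge : ℓ / ρm ≤ gapAlong τ Z r := by
    refine ge_of_tendsto (hDc.continuousWithinAt (s := Ioi r)) ?_
    filter_upwards [Ioo_mem_nhdsGT hr0] with x hx
    exact (hafter x hx.1 hx.2).1.le
  have hℓD : ℓ ≤ gapAlong τ Z r := S.ℓ_lt_div.le.trans hge
  -- A gap of `ℓ / ρm` is excluded by the mean speed over one period, equal speeds by comparison.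
  rcases hrB.2 with hrD | hrs
  · obtain ⟨ξ, hξ, hslope⟩ := exists_hasDerivAt_eq_slope Z _ (show r < r + τ by linarith)
      hZ.continuous.continuousOn fun x _ => hasDerivAt_trajectory hZ x
    rw [add_sub_cancel_left, eq_div_iff hτ.ne'] at hslope
    have h1 := S.le_speedAlong (hmono.mono (Ici_subset_Ici.mpr hξ.1.le))
      (hℓD.trans (hlt ξ hξ.1).le)
    have h2 : φ ρm < gapSpeed ℓ φ (gapAlong τ Z ξ) := by
      rw [← gapSpeed_div (φ := φ) S.ℓ_pos S.ρm_pos S.ρm_lt_one.le]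
      exact gapSpeed_strictMonoOn S.speed S.ℓ_pos (mem_Ici.mpr S.ℓ_lt_div.le)
        (mem_Ici.mpr (hℓD.trans (hlt ξ hξ.1).le)) (hge.trans_lt (hlt ξ hξ.1))
    have h3 : gapAlong τ Z r = speedAlong ℓ Vm Vp φ w N τ Z ξ * τ := hslope.symm
    have h4 : Vm * φ ρm < speedAlong ℓ Vm Vp φ w N τ Z ξ :=
      (mul_lt_mul_of_pos_left h2 S.Vm_pos).trans_le h1
    have h5 := mul_lt_mul_of_pos_left h4 hτ
    rw [S.τ_mul_Vm, mul_comm, ← h3] at h5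
    exact h5.not_ge hrD
  · obtain ⟨h1, h2⟩ := gaps_of_monotoneOn hτ hmono hℓD
    have h3 := queueSpeed_lt_succ_of_gap_lt S.speed S.weight S.h_pos S.ℓ_pos S.Vm_pos S.Vm_lt
      S.h_le (z := fun k => Z (r + k * τ)) h1 h2 (by
        have e0 := gap_eq_gapAlong τ Z r 0
        have e1 := gap_eq_gapAlong τ Z r 1
        simp only [Nat.cast_zero, zero_mul, add_zero, zero_add, Nat.cast_one, one_mul,
          Nat.reduceAdd, Nat.cast_ofNat] at e0 e1 ⊢
        rw [e0, e1]
        exact hlt _ (by linarith))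
    rw [← speedAlong_add] at h3
    exact h3.not_ge hrs

theorem strictMonoOn_gapAlong (S : StationarySetup ℓ h Vm Vp ρm ρp ρhat τ c N φ w)
    (hZ : IsAdvancedSolution (queueSpeed ℓ Vm Vp φ w N) τ c Z) :
    StrictMonoOn (gapAlong τ Z) (Iic 0) := by
  refine strictMonoOn_of_deriv_pos (convex_Iic 0) (continuous_gapAlong hZ).continuousOn
    fun x hx => ?_
  rw [interior_Iic] at hx
  rw [(hasDerivAt_gapAlong hZ x).deriv]
  linarith [(S.lt_gapAlong_and_speedAlong_lt hZ hx).2]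

theorem monotone_gapAlong (S : StationarySetup ℓ h Vm Vp ρm ρp ρhat τ c N φ w)
    (hZ : IsAdvancedSolution (queueSpeed ℓ Vm Vp φ w N) τ c Z) : Monotone (gapAlong τ Z) := by
  have hmin : ∀ x, gapAlong τ Z x = gapAlong τ Z (min x 0) := fun x => by
    rcases le_total x 0 with hx | hx
    · rw [min_eq_left hx]
    · rw [min_eq_right hx, S.gapAlong_of_nonneg hZ hx, S.gapAlong_of_nonneg hZ le_rfl]
  intro x y hxy
  rw [hmin x, hmin y]
  exact (S.strictMonoOn_gapAlong hZ).monotoneOn (mem_Iic.mpr (min_le_right _ _))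
    (mem_Iic.mpr (min_le_right _ _)) (min_le_min_right _ hxy)

theorem lt_gapAlong (S : StationarySetup ℓ h Vm Vp ρm ρp ρhat τ c N φ w)
    (hZ : IsAdvancedSolution (queueSpeed ℓ Vm Vp φ w N) τ c Z) (t : ℝ) :
    ℓ / ρm < gapAlong τ Z t := by
  rcases lt_or_ge t 0 with ht | ht
  · exact (S.lt_gapAlong_and_speedAlong_lt hZ ht).1
  · rw [S.gapAlong_of_nonneg hZ ht]
    exact S.div_lt_div

theorem ℓ_le_gap (S : StationarySetup ℓ h Vm Vp ρm ρp ρhat τ c N φ w)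
    (hZ : IsAdvancedSolution (queueSpeed ℓ Vm Vp φ w N) τ c Z) (t : ℝ) :
    ℓ ≤ gapAlong τ Z t :=
  S.ℓ_lt_div.le.trans (S.lt_gapAlong hZ t).le

theorem Vm_mul_le_speedAlong (S : StationarySetup ℓ h Vm Vp ρm ρp ρhat τ c N φ w)
    (hZ : IsAdvancedSolution (queueSpeed ℓ Vm Vp φ w N) τ c Z) (t : ℝ) :
    Vm * φ ρm ≤ speedAlong ℓ Vm Vp φ w N τ Z t := by
  refine le_trans ?_ (S.le_speedAlong ((S.monotone_gapAlong hZ).monotoneOn _) (S.ℓ_le_gap hZ t))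
  rw [← gapSpeed_div (φ := φ) S.ℓ_pos S.ρm_pos S.ρm_lt_one.le]
  exact mul_le_mul_of_nonneg_left
    (gapSpeed_monotone S.speed S.ℓ_pos (S.lt_gapAlong hZ t).le) S.Vm_pos.le

theorem speedAlong_pos (S : StationarySetup ℓ h Vm Vp ρm ρp ρhat τ c N φ w)
    (hZ : IsAdvancedSolution (queueSpeed ℓ Vm Vp φ w N) τ c Z) (t : ℝ) :
    0 < speedAlong ℓ Vm Vp φ w N τ Z t :=
  (mul_pos S.Vm_pos (S.speed.pos S.ρm_pos.le S.ρm_lt_one)).trans_le (S.Vm_mul_le_speedAlong hZ t)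

theorem strictMono_trajectory (S : StationarySetup ℓ h Vm Vp ρm ρp ρhat τ c N φ w)
    (hZ : IsAdvancedSolution (queueSpeed ℓ Vm Vp φ w N) τ c Z) : StrictMono Z :=
  strictMono_of_hasDerivAt_pos (hasDerivAt_trajectory hZ) (S.speedAlong_pos hZ)

theorem tendsto_trajectory (S : StationarySetup ℓ h Vm Vp ρm ρp ρhat τ c N φ w)
    (hZ : IsAdvancedSolution (queueSpeed ℓ Vm Vp φ w N) τ c Z) :
    Tendsto Z atTop atTop ∧ Tendsto Z atBot atBot :=
  tendsto_of_le_deriv (mul_pos S.Vm_pos (S.speed.pos S.ρm_pos.le S.ρm_lt_one))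
    (hasDerivAt_trajectory hZ) (S.Vm_mul_le_speedAlong hZ)

/-- The gap tends to `ℓ / ρm` at `-∞`: its limit `d` satisfies `d ≤ τ Vm φ(ℓ / d)`, and the flux is
injective below the stagnation density. -/
theorem tendsto_gapAlong_atBot (S : StationarySetup ℓ h Vm Vp ρm ρp ρhat τ c N φ w)
    (hZ : IsAdvancedSolution (queueSpeed ℓ Vm Vp φ w N) τ c Z) :
    Tendsto (gapAlong τ Z) atBot (𝓝 (ℓ / ρm)) := by
  have hτ := S.τ_pos
  have hmono := S.monotone_gapAlong hZ
  have hbdd : BddBelow (range (gapAlong τ Z)) :=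
    ⟨ℓ / ρm, by rintro _ ⟨t, rfl⟩; exact (S.lt_gapAlong hZ t).le⟩
  have hlim := tendsto_atBot_ciInf hmono hbdd
  set d := ⨅ t, gapAlong τ Z t with hd
  have hdge : ℓ / ρm ≤ d := le_ciInf fun t => (S.lt_gapAlong hZ t).le
  have hd0 : 0 < d := (div_pos S.ℓ_pos S.ρm_pos).trans_le hdge
  have hupper : ∀ᶠ t in atBot,
      gapAlong τ Z t ≤ τ * (Vm * gapSpeed ℓ φ (gapAlong τ Z (t + (N + 1) * τ))) := by
    -- Cars behind `-h` only see the speed limit `Vm`.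
    have hfar := (tendsto_atBot.mp ((S.tendsto_trajectory hZ).2.comp
      (tendsto_atBot_add_const_right _ τ tendsto_id))) (-h)
    filter_upwards [hfar] with t ht
    simp only [Function.comp, id] at ht
    obtain ⟨ξ, hξ, hslope⟩ := exists_hasDerivAt_eq_slope Z _ (show t < t + τ by linarith)
      hZ.continuous.continuousOn fun x _ => hasDerivAt_trajectory hZ x
    rw [add_sub_cancel_left, eq_div_iff hτ.ne'] at hslope
    have hZξ : Z ξ ≤ -h := ((S.strictMono_trajectory hZ) hξ.2).le.trans ht
    have h1 := queueSpeed_le (φ := φ) (M := gapSpeed ℓ φ (gapAlong τ Z (t + (N + 1) * τ)))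
      S.weight S.ℓ_pos S.Vm_pos S.Vm_lt S.h_le (z := fun k => Z (ξ + k * τ))
      (fun k => by rw [gap_eq_gapAlong]; exact S.ℓ_le_gap hZ _)
      (fun k hk => gapSpeed_monotone S.speed S.ℓ_pos (by
        rw [gap_eq_gapAlong]
        have : (k : ℝ) ≤ N := by exact_mod_cast hk.le
        have := mul_le_mul_of_nonneg_right this hτ.le
        exact hmono (by linarith [hξ.2])))
    have h2 : weightCDF w (-Z (ξ + ((0 : ℕ) : ℝ) * τ)) = 1 := S.weight.cdf_of_ge (by
      simp only [Nat.cast_zero, zero_mul, add_zero]; linarith)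
    rw [h2, show Vp - (Vp - Vm) * 1 = Vm by ring, mul_comm] at h1
    have h3 : gapAlong τ Z t = τ * speedAlong ℓ Vm Vp φ w N τ Z ξ := by
      rw [mul_comm]; exact hslope.symm
    rw [h3]
    exact mul_le_mul_of_nonneg_left h1 hτ.le
  have hlim' : Tendsto (fun t => gapAlong τ Z (t + (N + 1) * τ)) atBot (𝓝 d) :=
    hlim.comp (tendsto_atBot_add_const_right _ _ tendsto_id)
  have hle : d ≤ τ * (Vm * gapSpeed ℓ φ d) :=
    le_of_tendsto_of_tendsto hlim ((((gapSpeed_continuous S.speed S.ℓ_pos).tendsto d).comp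
      hlim').const_mul Vm |>.const_mul τ) hupper
  have hR0 : 0 < ℓ / d := div_pos S.ℓ_pos hd0
  have hRm : ℓ / d ≤ ρm := (div_le_comm₀ hd0 S.ρm_pos).mpr hdge
  have hflux : fluxFn φ ρm ≤ fluxFn φ (ℓ / d) := by
    rw [gapSpeed_of_le (S.ℓ_lt_div.le.trans hdge)] at hle
    have h1 : ℓ = τ * (Vm * fluxFn φ ρm) := by rw [S.flux_eq, S.τ_mul_flux]
    have h2 : τ * (Vm * fluxFn φ ρm) ≤ τ * (Vm * fluxFn φ (ℓ / d)) := by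
      rw [← h1, fluxFn]
      have := mul_le_mul_of_nonneg_left hle hR0.le
      rw [div_mul_cancel₀ _ hd0.ne'] at this
      linarith
    exact le_of_mul_le_mul_left (le_of_mul_le_mul_left h2 hτ) S.Vm_pos
  have hR : ρm ≤ ℓ / d := (S.strictMonoOn_flux.le_iff_le ⟨S.ρm_pos.le, S.ρm_le⟩
    ⟨hR0.le, hRm.trans S.ρm_le⟩).mp hflux
  have : d = ℓ / ρm := by
    rw [le_antisymm hR hRm, div_div_cancel₀ S.ℓ_pos.ne']
  rwa [← this]

end StationarySetup

theorem exists_inverse_of_deriv_pos {f f' : ℝ → ℝ} (hf : ∀ x, HasDerivAt f (f' x) x)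
    (hpos : ∀ x, 0 < f' x) (htop : Tendsto f atTop atTop) (hbot : Tendsto f atBot atBot) :
    ∃ g : ℝ → ℝ, (∀ x, f (g x) = x) ∧ (∀ x, g (f x) = x) ∧ StrictMono g ∧
      ∀ x, HasDerivAt g (f' (g x))⁻¹ x := by
  have hc : Continuous f := continuous_iff_continuousAt.mpr fun x => (hf x).continuousAt
  set e := (strictMono_of_hasDerivAt_pos hf hpos).orderIsoOfSurjective f
    (hc.surjective htop hbot) with he
  have h1 : ∀ x, f (e.symm x) = x := e.apply_symm_apply
  refine ⟨e.symm, h1, e.symm_apply_apply, e.symm.strictMono, fun x => ?_⟩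
  exact HasDerivAt.of_local_left_inverse e.symm.continuous.continuousAt (hf _) (hpos _).ne'
    (Eventually.of_forall h1)

/-! ### Averaged speeds generated by a profile -/

section profileDensity

variable {ℓ h Vm Vp : ℝ} {N : ℕ} {φ w P : ℝ → ℝ}

theorem carPosition_succ (hL : Function.Surjective (leader ℓ P)) (x : ℝ) (k : ℤ) :
    carPosition ℓ P x (k + 1) = leader ℓ P (carPosition ℓ P x k) := by
  have hinv := Function.rightInverse_invFun hL
  match k with
  | Int.ofNat n => exact Function.iterate_succ_apply' (leader ℓ P) n x
  | Int.negSucc 0 => exact (hinv x).symm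
  | Int.negSucc (n + 1) =>
    have h1 : Int.negSucc (n + 1) + 1 = Int.negSucc n := by omega
    rw [h1]
    simp only [carPosition]
    rw [Function.iterate_succ_apply' _ (n + 1), hinv]

theorem carPosition_add_nat (hL : Function.Surjective (leader ℓ P)) (x : ℝ) (i : ℤ) (k : ℕ) :
    carPosition ℓ P x (i + k) = (leader ℓ P)^[k] (carPosition ℓ P x i) := by
  induction k with
  | zero => simp
  | succ k ih =>
    rw [Function.iterate_succ_apply', ← ih, ← carPosition_succ hL]
    congr 1
    push_cast
    ring

theorem le_leader_sub (hℓ : 0 < ℓ) {x : ℝ} (h0 : 0 < P x) (h1 : P x ≤ 1) :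
    ℓ ≤ leader ℓ P x - x := by
  rw [leader, add_sub_cancel_left, le_div_iff₀ h0]
  exact mul_le_of_le_one_right hℓ.le h1

theorem eq_div_leader_sub (hℓ : 0 < ℓ) (x : ℝ) : P x = ℓ / (leader ℓ P x - x) := by
  rw [leader, add_sub_cancel_left, div_div_cancel₀ hℓ.ne']

/-- The speeds of a car at `x` and of its leader in the distribution generated by `P`. -/
theorem avgSpeed_profileDensity (hℓ : 0 < ℓ) (hh : 0 < h) (hw : IsWeight h w) (hN : h ≤ N * ℓ)
    (hL : Function.Surjective (leader ℓ P)) (h0 : ∀ x, 0 < P x) (h1 : ∀ x, P x ≤ 1) (x : ℝ) :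
    avgSpeed h (speedLimit Vm Vp) φ w (profileDensity ℓ P x) x =
        queueSpeed ℓ Vm Vp φ w N (fun k => (leader ℓ P)^[k] x) ∧
      avgSpeed h (speedLimit Vm Vp) φ w (profileDensity ℓ P x) (leader ℓ P x) =
        queueSpeed ℓ Vm Vp φ w N (fun k => (leader ℓ P)^[k] (leader ℓ P x)) := by
  have key := avgSpeed_stepFunction (Vm := Vm) (Vp := Vp) (φ := φ) hℓ hh hw hN
    (z := carPosition ℓ P x) (a := fun k => P (carPosition ℓ P x k))
    (fun k => by rw [carPosition_succ hL]; exact le_leader_sub hℓ (h0 _) (h1 _))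
    (fun k => by rw [carPosition_succ hL]; exact eq_div_leader_sub hℓ _)
  simp only [carPosition_add_nat hL] at key
  exact ⟨key 0, key 1⟩

end profileDensity

/-! ### The profile of the trajectory -/

namespace StationarySetup

variable {ℓ h Vm Vp ρm ρp ρhat τ c : ℝ} {N : ℕ} {φ w : ℝ → ℝ} {Z P T : ℝ → ℝ}

theorem leader_trajectory (S : StationarySetup ℓ h Vm Vp ρm ρp ρhat τ c N φ w)
    (hP : ∀ t, P (Z t) = ℓ / gapAlong τ Z t) (t : ℝ) : leader ℓ P (Z t) = Z (t + τ) := by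
  rw [leader, hP, div_div_cancel₀ S.ℓ_pos.ne', gapAlong]
  ring

theorem iterate_leader_trajectory (S : StationarySetup ℓ h Vm Vp ρm ρp ρhat τ c N φ w)
    (hP : ∀ t, P (Z t) = ℓ / gapAlong τ Z t) (t : ℝ) (k : ℕ) :
    (leader ℓ P)^[k] (Z t) = Z (t + k * τ) := by
  induction k with
  | zero => simp
  | succ k ih =>
    rw [Function.iterate_succ_apply', ih, S.leader_trajectory hP]
    push_cast
    ring_nf

theorem gapAlong_pos (S : StationarySetup ℓ h Vm Vp ρm ρp ρhat τ c N φ w)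
    (hZ : IsAdvancedSolution (queueSpeed ℓ Vm Vp φ w N) τ c Z) (t : ℝ) : 0 < gapAlong τ Z t :=
  S.ℓ_pos.trans_le (S.ℓ_le_gap hZ t)

theorem solves_of_trajectory (S : StationarySetup ℓ h Vm Vp ρm ρp ρhat τ c N φ w)
    (hZ : IsAdvancedSolution (queueSpeed ℓ Vm Vp φ w N) τ c Z)
    (hP : ∀ t, P (Z t) = ℓ / gapAlong τ Z t) (hZT : ∀ x, Z (T x) = x)
    (hT : ∀ x, HasDerivAt T (speedAlong ℓ Vm Vp φ w N τ Z (T x))⁻¹ x) :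
    SolvesProfileEq ℓ h (speedLimit Vm Vp) φ w P := by
  have hPT : ∀ x, P x = ℓ / gapAlong τ Z (T x) := fun x => by rw [← hP, hZT]
  have hpos : ∀ x, 0 < P x := fun x => by
    rw [hPT]; exact div_pos S.ℓ_pos (S.gapAlong_pos hZ _)
  have hle : ∀ x, P x ≤ 1 := fun x => by
    rw [hPT]; exact div_le_one_of_le₀ (S.ℓ_le_gap hZ _) (S.gapAlong_pos hZ _).le
  have hTc : Continuous T := continuous_iff_continuousAt.mpr fun x => (hT x).continuousAt
  have hsurj : Function.Surjective (leader ℓ P) := fun x =>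
    ⟨Z (T x - τ), by rw [S.leader_trajectory hP, sub_add_cancel, hZT]⟩
  have hsp : ∀ x,
      avgSpeed h (speedLimit Vm Vp) φ w (profileDensity ℓ P x) x =
          speedAlong ℓ Vm Vp φ w N τ Z (T x) ∧
        avgSpeed h (speedLimit Vm Vp) φ w (profileDensity ℓ P x) (leader ℓ P x) =
          speedAlong ℓ Vm Vp φ w N τ Z (T x + τ) := fun x => by
    obtain ⟨h1, h2⟩ := avgSpeed_profileDensity (Vm := Vm) (Vp := Vp) (φ := φ) S.ℓ_pos S.h_pos
      S.weight S.h_le hsurj hpos hle x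
    rw [h1, h2]
    have hx : leader ℓ P x = Z (T x + τ) := by rw [← S.leader_trajectory hP, hZT]
    constructor
    · conv_lhs => rw [← hZT x]
      simp only [S.iterate_leader_trajectory hP]
      rfl
    · rw [hx]
      simp only [S.iterate_leader_trajectory hP]
      rfl
  set s := speedAlong ℓ Vm Vp φ w N τ Z with hs
  have hspos : ∀ t, 0 < s t := S.speedAlong_pos hZ
  have hDpos := S.gapAlong_pos hZ
  have hder : ∀ x, HasDerivAt P
      (P x ^ 2 / (ℓ * s (T x)) * (s (T x) - s (T x + τ))) x := fun x => by
    have h1 := (hasDerivAt_gapAlong hZ (T x)).comp x (hT x)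
    have h2 := (h1.inv (hDpos _).ne').const_mul ℓ
    have hPf : P = fun y => ℓ * (gapAlong τ Z ∘ T)⁻¹ y := funext fun y => by
      rw [hPT, div_eq_mul_inv]; rfl
    rw [← hPf] at h2
    refine h2.congr_deriv ?_
    rw [hPT x]
    have h3 := (hspos (T x)).ne'
    have h4 := (hDpos (T x)).ne'
    have h5 := S.ℓ_pos.ne'
    simp only [Function.comp]
    field_simp
    ring
  refine ⟨?_, hpos, hle, fun x => ?_, fun x => ?_⟩
  · refine contDiff_one_iff_deriv.mpr ⟨fun x => (hder x).differentiableAt, ?_⟩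
    rw [funext fun x => (hder x).deriv]
    have hPc : Continuous P := continuous_iff_continuousAt.mpr fun x => (hder x).continuousAt
    have hsc : Continuous s := S.continuous_speedAlong hZ
    refine ((hPc.pow 2).div (by fun_prop) fun x => ?_).mul (by fun_prop)
    exact (mul_pos S.ℓ_pos (hspos _)).ne'
  · rw [(hsp x).1]
    exact hspos _
  · rw [(hder x).deriv, (hsp x).1, (hsp x).2]

theorem isStationaryWaveProfile_of_trajectory
    (S : StationarySetup ℓ h Vm Vp ρm ρp ρhat τ c N φ w)
    (hZ : IsAdvancedSolution (queueSpeed ℓ Vm Vp φ w N) τ c Z)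
    (hP : ∀ t, P (Z t) = ℓ / gapAlong τ Z t) (hZT : ∀ x, Z (T x) = x) :
    IsStationaryWaveProfile ℓ h (speedLimit Vm Vp) φ w P := by
  intro z₀ hz₀
  set a := T (z₀ 0) with ha
  -- The given cars are points of the single trajectory `Z`, spaced by the delay `τ`.
  have hstart : ∀ i : ℤ, z₀ i = Z (a + i * τ) := by
    intro i
    induction i using Int.induction_on with
    | zero => simp [ha, hZT]
    | succ n ih =>
      rw [hz₀, ih, S.leader_trajectory hP]
      push_cast
      ring_nf
    | pred n ih =>
      have h1 := hz₀ (-n - 1)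
      rw [sub_add_cancel, ih, ← hZT (z₀ (-n - 1)), S.leader_trajectory hP] at h1
      have h2 := (S.strictMono_trajectory hZ).injective h1
      rw [← hZT (z₀ (-n - 1))]
      congr 1
      push_cast at h2 ⊢
      linarith
  have hgap : ∀ (t : ℝ) (i : ℤ), Z (t + a + (i + 1 : ℤ) * τ) - Z (t + a + i * τ) =
      gapAlong τ Z (t + a + i * τ) := fun t i => by
    rw [gapAlong]
    push_cast
    ring_nf
  refine ⟨fun i t => Z (t + a + i * τ), ⟨fun t _ i => ?_, fun t _ i => ?_⟩, fun i => ?_,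
    fun i t _ => ?_⟩
  · have h1 := S.ℓ_le_gap hZ (t + a + i * τ)
    have h2 := hgap t i
    linarith
  · have h1 := avgSpeed_stepFunction (Vm := Vm) (Vp := Vp) (φ := φ) S.ℓ_pos S.h_pos S.weight S.h_le
      (z := fun j : ℤ => Z (t + a + j * τ))
      (a := discreteDensity ℓ fun j : ℤ => Z (t + a + j * τ))
      (fun k => by rw [hgap]; exact S.ℓ_le_gap hZ _) (fun k => rfl) i
    rw [h1]
    have h2 : HasDerivAt Z (queueSpeed ℓ Vm Vp φ w N
        fun k : ℕ => Z (t + a + ((i + k : ℤ) : ℝ) * τ)) (t + (a + i * τ)) := by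
      refine (hZ.hasDerivAt _).congr_deriv ?_
      congr 1
      funext k
      push_cast
      ring_nf
    have h3 := (h2.comp_add_const t (a + i * τ)).hasDerivWithinAt (s := Ici 0)
    simpa only [add_assoc] using h3
  · simp only [zero_add]
    exact (hstart i).symm
  · simp only [discreteDensity]
    rw [hP, hgap]

theorem exists_profile (S : StationarySetup ℓ h Vm Vp ρm ρp ρhat τ c N φ w)
    (hZ : IsAdvancedSolution (queueSpeed ℓ Vm Vp φ w N) τ c Z) :
    ∃ P : ℝ → ℝ, SolvesAsymptoticValueProblem ℓ h (speedLimit Vm Vp) φ w ρm ρp P ∧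
      IsStationaryWaveProfile ℓ h (speedLimit Vm Vp) φ w P ∧ (∀ x, 0 ≤ x → P x = ρp) ∧
      StrictAntiOn P (Iio 0) ∧ ∀ t, P (Z t) = ℓ / gapAlong τ Z t := by
  obtain ⟨htop, hbot⟩ := S.tendsto_trajectory hZ
  obtain ⟨T, hZT, hTZ, hTmono, hT⟩ := exists_inverse_of_deriv_pos (hasDerivAt_trajectory hZ)
    (S.speedAlong_pos hZ) htop hbot
  set P : ℝ → ℝ := fun x => ℓ / gapAlong τ Z (T x) with hPdef
  have hP : ∀ t, P (Z t) = ℓ / gapAlong τ Z t := fun t => by rw [hPdef]; simp only [hTZ]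
  have hT0 : T 0 = 0 := by
    have := hTZ 0
    rwa [hZ.linear 0 le_rfl, mul_zero] at this
  have hconst : ∀ x, 0 ≤ x → P x = ρp := fun x hx => by
    have : 0 ≤ T x := hT0 ▸ hTmono.monotone hx
    rw [hPdef]
    simp only
    rw [S.gapAlong_of_nonneg hZ this, div_div_cancel₀ S.ℓ_pos.ne']
  have hTbot : Tendsto T atBot atBot := by
    refine tendsto_atBot.mpr fun b => ?_
    filter_upwards [eventually_le_atBot (Z b)] with x hx
    rw [← hTZ b]
    exact hTmono.monotone hx
  refine ⟨P, ⟨S.solves_of_trajectory hZ hP hZT hT, ?_, ?_⟩,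
    S.isStationaryWaveProfile_of_trajectory hZ hP hZT, hconst, ?_, hP⟩
  · have h1 := (S.tendsto_gapAlong_atBot hZ).comp hTbot
    have h2 := (tendsto_const_nhds (x := ℓ)).div h1 (div_pos S.ℓ_pos S.ρm_pos).ne'
    rwa [div_div_cancel₀ S.ℓ_pos.ne'] at h2
  · refine tendsto_const_nhds.congr' ?_
    filter_upwards [eventually_ge_atTop 0] with x hx
    exact (hconst x hx).symm
  · intro x hx y hy hxy
    have hy0 : T y < 0 := hT0 ▸ hTmono hy
    have hx0 : T x < 0 := hT0 ▸ hTmono hx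
    exact div_lt_div_of_pos_left S.ℓ_pos (S.gapAlong_pos hZ _)
      (S.strictMonoOn_gapAlong hZ (mem_Iic.mpr hx0.le) (mem_Iic.mpr hy0.le) (hTmono hxy))

end StationarySetup

/-! ### Uniqueness of the profile -/

/-- A continuous function with limit below `μ` at `+∞` has a last point at which it takes the value
`μ`, provided it reaches that value at all. -/
theorem exists_last_crossing {f : ℝ → ℝ} (hf : Continuous f) {a μ x₀ : ℝ}
    (hlim : Tendsto f atTop (𝓝 a)) (ha : a < μ) (hx₀ : μ ≤ f x₀) :
    ∃ x, x₀ ≤ x ∧ f x = μ ∧ ∀ y, x ≤ y → f y ≤ μ := by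
  obtain ⟨b, hb⟩ := eventually_atTop.mp (hlim.eventually (gt_mem_nhds ha))
  set s : Set ℝ := Ici x₀ ∩ {x | μ ≤ f x}
  have hsb : BddAbove s := ⟨b, fun x hx => not_lt.mp fun h => (hb x h.le).not_ge hx.2⟩
  have hs : sSup s ∈ s :=
    (isClosed_Ici.inter (isClosed_le continuous_const hf)).csSup_mem ⟨x₀, self_mem_Ici, hx₀⟩ hsb
  have hafter : ∀ y, sSup s < y → f y < μ := fun y hy => not_le.mp fun h =>
    hy.not_ge (le_csSup hsb ⟨hs.1.trans hy.le, h⟩)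
  have heq : f (sSup s) = μ := by
    refine le_antisymm (le_of_tendsto (hf.continuousWithinAt (s := Ioi (sSup s))) ?_) hs.2
    filter_upwards [self_mem_nhdsWithin] with y hy
    exact (hafter y hy).le
  refine ⟨sSup s, hs.1, heq, fun y hy => ?_⟩
  rcases hy.eq_or_lt with rfl | hy
  · exact heq.le
  · exact (hafter y hy).le

/-- The speed of a car at `x` whose leaders are determined by the profile `Q`. -/
def profileSpeed (ℓ Vm Vp : ℝ) (φ w : ℝ → ℝ) (N : ℕ) (Q : ℝ → ℝ) (x : ℝ) : ℝ :=
  queueSpeed ℓ Vm Vp φ w N fun k => (leader ℓ Q)^[k] x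

namespace StationarySetup

variable {ℓ h Vm Vp ρm ρp ρhat τ c : ℝ} {N : ℕ} {φ w : ℝ → ℝ} {Q : ℝ → ℝ}

theorem continuous_leader
    (hQ : SolvesAsymptoticValueProblem ℓ h (speedLimit Vm Vp) φ w ρm ρp Q) :
    Continuous (leader ℓ Q) :=
  continuous_id.add (continuous_const.div hQ.contDiff.continuous fun x => (hQ.pos x).ne')

theorem le_leader (S : StationarySetup ℓ h Vm Vp ρm ρp ρhat τ c N φ w)
    (hQ : SolvesAsymptoticValueProblem ℓ h (speedLimit Vm Vp) φ w ρm ρp Q) (x : ℝ) :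
    x + ℓ ≤ leader ℓ Q x := by
  linarith [le_leader_sub (P := Q) S.ℓ_pos (hQ.pos x) (hQ.le_one x)]

theorem le_iterate_leader (S : StationarySetup ℓ h Vm Vp ρm ρp ρhat τ c N φ w)
    (hQ : SolvesAsymptoticValueProblem ℓ h (speedLimit Vm Vp) φ w ρm ρp Q) (k : ℕ) (x : ℝ) :
    x ≤ (leader ℓ Q)^[k] x := by
  induction k with
  | zero => exact le_rfl
  | succ k ih =>
    rw [Function.iterate_succ_apply']
    linarith [S.le_leader hQ ((leader ℓ Q)^[k] x), S.ℓ_pos]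

/-- Surjectivity of the leader map makes the followers in `carPosition` genuine ones, before its
injectivity is known. -/
theorem surjective_leader (S : StationarySetup ℓ h Vm Vp ρm ρp ρhat τ c N φ w)
    (hQ : SolvesAsymptoticValueProblem ℓ h (speedLimit Vm Vp) φ w ρm ρp Q) :
    Function.Surjective (leader ℓ Q) := by
  refine (continuous_leader hQ).surjective ?_ ?_
  · exact tendsto_atTop_mono (fun x => S.le_leader hQ x)
      (tendsto_atTop_add_const_right _ ℓ tendsto_id)
  · exact tendsto_id.atBot_add
      ((tendsto_const_nhds (x := ℓ)).div hQ.tendsto_atBot S.ρm_pos.ne')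

theorem avgSpeed_eq_profileSpeed (S : StationarySetup ℓ h Vm Vp ρm ρp ρhat τ c N φ w)
    (hQ : SolvesAsymptoticValueProblem ℓ h (speedLimit Vm Vp) φ w ρm ρp Q) (x : ℝ) :
    avgSpeed h (speedLimit Vm Vp) φ w (profileDensity ℓ Q x) x =
        profileSpeed ℓ Vm Vp φ w N Q x ∧
      avgSpeed h (speedLimit Vm Vp) φ w (profileDensity ℓ Q x) (leader ℓ Q x) =
        profileSpeed ℓ Vm Vp φ w N Q (leader ℓ Q x) :=
  avgSpeed_profileDensity S.ℓ_pos S.h_pos S.weight S.h_le (S.surjective_leader hQ) hQ.pos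
    hQ.le_one x

theorem profileSpeed_pos (S : StationarySetup ℓ h Vm Vp ρm ρp ρhat τ c N φ w)
    (hQ : SolvesAsymptoticValueProblem ℓ h (speedLimit Vm Vp) φ w ρm ρp Q) (x : ℝ) :
    0 < profileSpeed ℓ Vm Vp φ w N Q x := by
  rw [← (S.avgSpeed_eq_profileSpeed hQ x).1]
  exact hQ.speed_pos x

theorem continuous_profileSpeed (S : StationarySetup ℓ h Vm Vp ρm ρp ρhat τ c N φ w)
    (hQ : SolvesAsymptoticValueProblem ℓ h (speedLimit Vm Vp) φ w ρm ρp Q) :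
    Continuous (profileSpeed ℓ Vm Vp φ w N Q) :=
  queueSpeed_continuous S.speed S.weight S.ℓ_pos fun k => (continuous_leader hQ).iterate k

theorem hasDerivAt_leader (S : StationarySetup ℓ h Vm Vp ρm ρp ρhat τ c N φ w)
    (hQ : SolvesAsymptoticValueProblem ℓ h (speedLimit Vm Vp) φ w ρm ρp Q) (x : ℝ) :
    HasDerivAt (leader ℓ Q) (profileSpeed ℓ Vm Vp φ w N Q (leader ℓ Q x) /
      profileSpeed ℓ Vm Vp φ w N Q x) x := by
  have h1 : HasDerivAt Q (deriv Q x) x :=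
    (hQ.contDiff.differentiable one_ne_zero x).hasDerivAt
  rw [hQ.deriv_eq x, (S.avgSpeed_eq_profileSpeed hQ x).1, (S.avgSpeed_eq_profileSpeed hQ x).2] at h1
  have h2 := (hasDerivAt_id x).add ((h1.inv (hQ.pos x).ne').const_mul ℓ)
  refine HasDerivAt.congr_deriv (f := leader ℓ Q) h2 ?_
  have h3 := (hQ.pos x).ne'
  have h4 := (S.profileSpeed_pos hQ x).ne'
  have h5 := S.ℓ_pos.ne'
  field_simp
  ring

/-- The time in which a car moving with the speed of the profile reaches the position of its leader
does not depend on the car: in terms of the speed `A` and the leader map `L`, the profile equation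
reads `L'(x) = A(L x) / A(x)`, so that `∫_x^{L x} dy / A(y)` is a first integral. -/
theorem exists_clock (S : StationarySetup ℓ h Vm Vp ρm ρp ρhat τ c N φ w)
    (hQ : SolvesAsymptoticValueProblem ℓ h (speedLimit Vm Vp) φ w ρm ρp Q) :
    ∃ (F : ℝ → ℝ) (σ : ℝ), F 0 = 0 ∧
      (∀ x, HasDerivAt F (profileSpeed ℓ Vm Vp φ w N Q x)⁻¹ x) ∧
      ∀ x, F (leader ℓ Q x) = F x + σ := by
  set A := profileSpeed ℓ Vm Vp φ w N Q with hA
  have hpos : ∀ x, 0 < A x := S.profileSpeed_pos hQ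
  have hc : Continuous fun x => (A x)⁻¹ :=
    (S.continuous_profileSpeed hQ).inv₀ fun x => (hpos x).ne'
  set F : ℝ → ℝ := fun x => ∫ y in (0 : ℝ)..x, (A y)⁻¹ with hF
  have hder : ∀ x, HasDerivAt F (A x)⁻¹ x := fun x =>
    intervalIntegral.integral_hasDerivAt_right (hc.intervalIntegrable _ _)
      (hc.stronglyMeasurableAtFilter _ _) hc.continuousAt
  have hzero : ∀ x, HasDerivAt (fun x => F (leader ℓ Q x) - F x) 0 x := fun x => by
    refine (((hder _).comp x (S.hasDerivAt_leader hQ x)).sub (hder x)).congr_deriv ?_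
    have h1 := (hpos x).ne'
    have h2 := (hpos (leader ℓ Q x)).ne'
    simp only [← hA]
    field_simp
    ring
  refine ⟨F, F (leader ℓ Q 0) - F 0, by simp [hF], hder, fun x => ?_⟩
  have := is_const_of_deriv_eq_zero (fun x => (hzero x).differentiableAt)
    (fun x => (hzero x).deriv) x 0
  linarith

/-- The mean value form of the first integral. -/
theorem exists_mul_profileSpeed_eq (S : StationarySetup ℓ h Vm Vp ρm ρp ρhat τ c N φ w)
    (hQ : SolvesAsymptoticValueProblem ℓ h (speedLimit Vm Vp) φ w ρm ρp Q) {F : ℝ → ℝ} {σ : ℝ}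
    (hF : ∀ x, HasDerivAt F (profileSpeed ℓ Vm Vp φ w N Q x)⁻¹ x)
    (hσ : ∀ x, F (leader ℓ Q x) = F x + σ) (x : ℝ) :
    ∃ ξ, x < ξ ∧ σ * profileSpeed ℓ Vm Vp φ w N Q ξ * Q x = ℓ := by
  have hlt : x < leader ℓ Q x := by linarith [S.le_leader hQ x, S.ℓ_pos]
  obtain ⟨ξ, hξ, hslope⟩ := exists_hasDerivAt_eq_slope F _ hlt
    (continuous_iff_continuousAt.mpr fun x => (hF x).continuousAt).continuousOn fun x _ => hF x
  refine ⟨ξ, hξ.1, ?_⟩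
  have h1 := (S.profileSpeed_pos hQ ξ).ne'
  have h2 := (hQ.pos x).ne'
  have h3 := S.ℓ_pos.ne'
  rw [hσ, add_sub_cancel_left, leader, add_sub_cancel_left] at hslope
  field_simp at hslope
  linarith

theorem iterate_leader_gap (S : StationarySetup ℓ h Vm Vp ρm ρp ρhat τ c N φ w)
    (hQ : SolvesAsymptoticValueProblem ℓ h (speedLimit Vm Vp) φ w ρm ρp Q) (x : ℝ) (k : ℕ) :
    ℓ ≤ (leader ℓ Q)^[k + 1] x - (leader ℓ Q)^[k] x ∧
      gapSpeed ℓ φ ((leader ℓ Q)^[k + 1] x - (leader ℓ Q)^[k] x) =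
        φ (Q ((leader ℓ Q)^[k] x)) := by
  rw [Function.iterate_succ_apply']
  refine ⟨le_leader_sub S.ℓ_pos (hQ.pos _) (hQ.le_one _), ?_⟩
  rw [leader, add_sub_cancel_left, gapSpeed_div S.ℓ_pos (hQ.pos _) (hQ.le_one _)]

/-- On `x ≥ 0` the speed limit is `Vp`, and only the densities ahead matter. -/
theorem profileSpeed_le (S : StationarySetup ℓ h Vm Vp ρm ρp ρhat τ c N φ w)
    (hQ : SolvesAsymptoticValueProblem ℓ h (speedLimit Vm Vp) φ w ρm ρp Q) {x M : ℝ}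
    (hx : 0 ≤ x) (hM : ∀ y, x ≤ y → φ (Q y) ≤ M) :
    profileSpeed ℓ Vm Vp φ w N Q x ≤ M * Vp := by
  have h1 := queueSpeed_le (φ := φ) (M := M) S.weight S.ℓ_pos S.Vm_pos S.Vm_lt S.h_le
    (z := fun k => (leader ℓ Q)^[k] x) (fun k => (S.iterate_leader_gap hQ x k).1)
    (fun k _ => (S.iterate_leader_gap hQ x k).2.trans_le (hM _ (S.le_iterate_leader hQ k x)))
  simp only [Function.iterate_zero, id] at h1
  rwa [S.weight.cdf_of_nonpos (neg_nonpos.mpr hx), mul_zero, sub_zero] at h1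

theorem le_profileSpeed (S : StationarySetup ℓ h Vm Vp ρm ρp ρhat τ c N φ w)
    (hQ : SolvesAsymptoticValueProblem ℓ h (speedLimit Vm Vp) φ w ρm ρp Q) {x M : ℝ}
    (hx : 0 ≤ x) (hM : ∀ y, x ≤ y → M ≤ φ (Q y)) :
    M * Vp ≤ profileSpeed ℓ Vm Vp φ w N Q x := by
  have h1 := le_queueSpeed (φ := φ) (M := M) S.weight S.ℓ_pos S.Vm_pos S.Vm_lt S.h_le
    (z := fun k => (leader ℓ Q)^[k] x) (fun k => (S.iterate_leader_gap hQ x k).1)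
    (fun k _ => (hM _ (S.le_iterate_leader hQ k x)).trans_eq (S.iterate_leader_gap hQ x k).2.symm)
  simp only [Function.iterate_zero, id] at h1
  rwa [S.weight.cdf_of_nonpos (neg_nonpos.mpr hx), mul_zero, sub_zero] at h1

theorem tendsto_profileSpeed_atTop (S : StationarySetup ℓ h Vm Vp ρm ρp ρhat τ c N φ w)
    (hQ : SolvesAsymptoticValueProblem ℓ h (speedLimit Vm Vp) φ w ρm ρp Q) :
    Tendsto (profileSpeed ℓ Vm Vp φ w N Q) atTop (𝓝 c) := by
  have hVp := S.Vp_pos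
  have hφQ : Tendsto (fun x => φ (Q x)) atTop (𝓝 (φ ρp)) :=
    (S.speed.continuousOn.continuousAt (Icc_mem_nhds S.ρp_pos S.ρp_lt_one)).tendsto.comp
      hQ.tendsto_atTop
  have hc : c / Vp = φ ρp := by rw [S.c_eq, mul_div_cancel_left₀ _ hVp.ne']
  refine tendsto_order.mpr ⟨fun a ha => ?_, fun a ha => ?_⟩
  · obtain ⟨m, hm1, hm2⟩ := exists_between (hc ▸ div_lt_div_of_pos_right ha hVp)
    obtain ⟨b, hb⟩ := eventually_atTop.mp (hφQ.eventually (lt_mem_nhds hm2))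
    filter_upwards [eventually_ge_atTop (max b 0)] with x hx
    exact ((div_lt_iff₀ hVp).mp hm1).trans_le (S.le_profileSpeed hQ ((le_max_right _ _).trans hx)
      fun y hy => (hb y ((le_max_left _ _).trans (hx.trans hy))).le)
  · obtain ⟨m, hm1, hm2⟩ := exists_between (hc ▸ div_lt_div_of_pos_right ha hVp)
    obtain ⟨b, hb⟩ := eventually_atTop.mp (hφQ.eventually (gt_mem_nhds hm1))
    filter_upwards [eventually_ge_atTop (max b 0)] with x hx
    exact (S.profileSpeed_le hQ ((le_max_right _ _).trans hx)
      fun y hy => (hb y ((le_max_left _ _).trans (hx.trans hy))).le).trans_lt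
        ((lt_div_iff₀ hVp).mp hm2)

/-- The state at `+∞` determines the constant of the first integral. -/
theorem clock_eq_period (S : StationarySetup ℓ h Vm Vp ρm ρp ρhat τ c N φ w)
    (hQ : SolvesAsymptoticValueProblem ℓ h (speedLimit Vm Vp) φ w ρm ρp Q) {F : ℝ → ℝ} {σ : ℝ}
    (hF : ∀ x, HasDerivAt F (profileSpeed ℓ Vm Vp φ w N Q x)⁻¹ x)
    (hσ : ∀ x, F (leader ℓ Q x) = F x + σ) : σ = τ := by
  choose ξ hξ heq using S.exists_mul_profileSpeed_eq hQ hF hσ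
  have hξtop : Tendsto ξ atTop atTop := tendsto_atTop_mono (fun x => (hξ x).le) tendsto_id
  have h1 := (((S.tendsto_profileSpeed_atTop hQ).comp hξtop).const_mul σ).mul hQ.tendsto_atTop
  have h2 : σ * c * ρp = ℓ :=
    tendsto_nhds_unique h1 (tendsto_const_nhds.congr fun x => (heq x).symm)
  rw [S.τ_eq, eq_div_iff (mul_pos S.ρp_pos S.c_pos).ne', ← h2]
  ring

/-- On `x ≥ 0` a solution is constant. If it reached a value `μ` with `ρp < μ ≤ ρhat`, then at the
last such point it would be at most `μ` from there on, and the first integral would give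
`f(μ) ≤ f(ρp)`; values below `ρp` are excluded in the same way. -/
theorem eq_of_nonneg (S : StationarySetup ℓ h Vm Vp ρm ρp ρhat τ c N φ w)
    (hQ : SolvesAsymptoticValueProblem ℓ h (speedLimit Vm Vp) φ w ρm ρp Q) {x : ℝ}
    (hx : 0 ≤ x) : Q x = ρp := by
  obtain ⟨F, σ, -, hF, hσ⟩ := S.exists_clock hQ
  obtain rfl := S.clock_eq_period hQ hF hσ
  have hτ := S.τ_pos
  have hQc := hQ.contDiff.continuous
  have hflux := S.τ_mul_flux
  have hanti := S.speed.strictAntiOn.antitoneOn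
  have hmem : ∀ y, Q y ∈ Icc (0 : ℝ) 1 := fun y => ⟨(hQ.pos y).le, hQ.le_one y⟩
  have hρp : ρp ∈ Icc 0 ρhat := ⟨S.ρp_pos.le, S.ρp_lt.le.trans S.ρm_le⟩
  refine le_antisymm (not_lt.mp fun hgt => ?_) (not_lt.mp fun hlt => ?_)
  · have hμ : ρp < min (Q x) ρhat := lt_min hgt (S.ρp_lt.trans_le S.ρm_le)
    obtain ⟨y, hxy, hy, hmax⟩ := exists_last_crossing hQc hQ.tendsto_atTop hμ (min_le_left _ _)
    obtain ⟨ξ, hξ, heq⟩ := S.exists_mul_profileSpeed_eq hQ hF hσ y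
    have h1 := S.le_profileSpeed hQ (x := ξ) (M := φ (Q y)) ((hx.trans hxy).trans hξ.le)
      fun r hr => hanti (hmem r) (hmem y) (by rw [hy]; exact hmax r (hξ.le.trans hr))
    have h2 : fluxFn φ ρp < fluxFn φ (Q y) :=
      S.strictMonoOn_flux hρp ⟨(hmem y).1, hy ▸ min_le_right _ _⟩ (hy ▸ hμ)
    have h3 : σ * (φ (Q y) * Vp) * Q y ≤ ℓ := heq ▸ by
      have := hQ.pos y
      gcongr
    have h4 := mul_lt_mul_of_pos_left (mul_lt_mul_of_pos_left h2 S.Vp_pos) hτ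
    rw [hflux] at h4
    simp only [fluxFn] at h4
    linarith
  · obtain ⟨y, hxy, hy, hmin⟩ := exists_last_crossing hQc.neg hQ.tendsto_atTop.neg
      (neg_lt_neg hlt) le_rfl
    have hy' : Q y = Q x := neg_inj.mp hy
    obtain ⟨ξ, hξ, heq⟩ := S.exists_mul_profileSpeed_eq hQ hF hσ y
    have h1 := S.profileSpeed_le hQ (x := ξ) (M := φ (Q y)) ((hx.trans hxy).trans hξ.le)
      fun r hr => hanti (hmem y) (hmem r)
        (hy'.trans_le (neg_le_neg_iff.mp (hmin r (hξ.le.trans hr))))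
    have h2 : fluxFn φ (Q y) < fluxFn φ ρp :=
      S.strictMonoOn_flux ⟨(hmem y).1, (hy'.trans_lt hlt).le.trans hρp.2⟩ hρp (hy'.trans_lt hlt)
    have h3 : ℓ ≤ σ * (φ (Q y) * Vp) * Q y := heq ▸ by
      have := hQ.pos y
      gcongr
    have h4 := mul_lt_mul_of_pos_left (mul_lt_mul_of_pos_left h2 S.Vp_pos) hτ
    rw [hflux] at h4
    simp only [fluxFn] at h4
    linarith

/-- Every solution is the profile of a trajectory of the equation with advanced arguments. -/
theorem exists_trajectory_of_solves (S : StationarySetup ℓ h Vm Vp ρm ρp ρhat τ c N φ w)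
    (hQ : SolvesAsymptoticValueProblem ℓ h (speedLimit Vm Vp) φ w ρm ρp Q) :
    ∃ Z, IsAdvancedSolution (queueSpeed ℓ Vm Vp φ w N) τ c Z ∧
      ∀ t, Q (Z t) = ℓ / gapAlong τ Z t := by
  obtain ⟨F, σ, hF0, hF, hσ⟩ := S.exists_clock hQ
  obtain rfl := S.clock_eq_period hQ hF hσ
  set A := profileSpeed ℓ Vm Vp φ w N Q with hA
  have hpos : ∀ x, 0 < A x := S.profileSpeed_pos hQ
  have hbd : ∀ x, A x ≤ N * Vp := fun x => (le_abs_self _).trans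
    (abs_queueSpeed_le S.speed S.weight S.ℓ_pos S.Vm_pos S.Vm_lt _)
  have hb0 : 0 < N * Vp := (hpos 0).trans_le (hbd 0)
  obtain ⟨htop, hbot⟩ := tendsto_of_le_deriv (inv_pos.mpr hb0) hF
    fun x => inv_anti₀ (hpos x) (hbd x)
  obtain ⟨Z, hFZ, hZF, -, hZ⟩ := exists_inverse_of_deriv_pos hF (fun x => inv_pos.mpr (hpos x))
    htop hbot
  have hlead : ∀ t, leader ℓ Q (Z t) = Z (t + σ) := fun t => by
    rw [← hZF (leader ℓ Q (Z t)), hσ, hFZ]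
  have hiter : ∀ (t : ℝ) (k : ℕ), (leader ℓ Q)^[k] (Z t) = Z (t + k * σ) := fun t k => by
    induction k with
    | zero => simp
    | succ k ih =>
      rw [Function.iterate_succ_apply', ih, hlead]
      push_cast
      ring_nf
  have hAc : ∀ x, 0 ≤ x → A x = c := fun x hx => by
    have hφ : ∀ y, x ≤ y → φ (Q y) = φ ρp := fun y hy => by rw [S.eq_of_nonneg hQ (hx.trans hy)]
    rw [S.c_eq, mul_comm]
    exact le_antisymm (S.profileSpeed_le hQ hx fun y hy => (hφ y hy).le)
      (S.le_profileSpeed hQ hx fun y hy => (hφ y hy).ge)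
  refine ⟨Z, ⟨fun t ht => ?_, fun t => ?_⟩, fun t => ?_⟩
  · have hc := S.c_pos
    have hint : ∫ y in (0 : ℝ)..(c * t), (A y)⁻¹ = F (c * t) - F 0 :=
      intervalIntegral.integral_eq_sub_of_hasDerivAt (fun x _ => hF x)
        (((S.continuous_profileSpeed hQ).inv₀ fun x => (hpos x).ne').intervalIntegrable _ _)
    rw [intervalIntegral.integral_congr (g := fun _ => c⁻¹) fun y hy => ?_, hF0,
      intervalIntegral.integral_const, smul_eq_mul, sub_zero, sub_zero, mul_comm c t,
      mul_inv_cancel_right₀ hc.ne'] at hint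
    · rw [mul_comm c t]
      conv_lhs => rw [hint, hZF]
    · rw [uIcc_of_le (mul_nonneg hc.le ht)] at hy
      simp only [hAc y hy.1]
  · have h1 := hZ t
    rw [inv_inv] at h1
    simpa only [hA, profileSpeed, hiter] using h1
  · rw [gapAlong, ← hlead]
    exact eq_div_leader_sub S.ℓ_pos _

end StationarySetup

end

theorem mainTheorem4 (ℓ h Vm Vp ρm ρp ρhat : ℝ) (φ w : ℝ → ℝ)
    (hℓ : 0 < ℓ) (hh : 0 < h) (hw : IsWeight h w) (hφ : IsSpeedFunction φ)
    (hVm : 0 < Vm) (hV : Vm < Vp)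
    (hρhat : ρhat ∈ Icc (0 : ℝ) 1) (hstag : derivWithin (fluxFn φ) (Icc 0 1) ρhat = 0)
    (hρp : 0 < ρp) (hρ : ρp < ρm) (hρm : ρm ≤ ρhat)
    (hflux : Vm * fluxFn φ ρm = Vp * fluxFn φ ρp) :
    ∃ P : ℝ → ℝ,
      SolvesAsymptoticValueProblem ℓ h (speedLimit Vm Vp) φ w ρm ρp P ∧
      IsStationaryWaveProfile ℓ h (speedLimit Vm Vp) φ w P ∧
      (∀ x, 0 ≤ x → P x = ρp) ∧
      StrictAntiOn P (Iio 0) ∧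
      ∀ Q : ℝ → ℝ,
        SolvesAsymptoticValueProblem ℓ h (speedLimit Vm Vp) φ w ρm ρp Q → Q = P := by
  obtain ⟨N, hN⟩ := exists_nat_ge (h / ℓ)
  have S : StationarySetup ℓ h Vm Vp ρm ρp ρhat (ℓ / (ρp * (Vp * φ ρp))) (Vp * φ ρp) N φ w :=
    ⟨hℓ, hh, hw, hφ, hVm, hV, hρhat, hstag, hρp, hρ, hρm, hflux, rfl, rfl, (div_le_iff₀ hℓ).mp hN⟩
  obtain ⟨Z, hZ, huniq⟩ := S.existsUnique_trajectory
  obtain ⟨P, hsolves, hwave, hconst, hanti, hP⟩ := S.exists_profile hZ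
  refine ⟨P, hsolves, hwave, hconst, hanti, fun Q hQ => ?_⟩
  obtain ⟨Z', hZ', hQ'⟩ := S.exists_trajectory_of_solves hQ
  obtain rfl := huniq Z' hZ'
  obtain ⟨htop, hbot⟩ := S.tendsto_trajectory hZ
  funext x
  obtain ⟨t, rfl⟩ := hZ.continuous.surjective htop hbot x
  rw [hQ', hP]
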